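/- Let $d\ge 2$. Call $x,y\in\mathbb Z^d$ neighbours ($x\sim y$) if $\|x-y\|_{\ell^1}=1$. For $V\subset\mathbb Z^d$ let $\partial V$ be the set of points of $V$ that have a neighbour outside $V$. For $R>0$ put $$Z_R=\{\xi\in\mathbb Z^d:|\xi|\le R\}\cup\{x\in\mathbb Z^d:\exists\,\xi\in\mathbb Z^d,\ \xi\sim x,\ |\xi|\le R<|x|\},$$ where $|\cdot|$ is the Euclidean norm. The boundary sandpile $\mathrm{BS}(\mu_0,\kappa_0)$ with initial mass distribution $\mu_0:\mathbb Z^d\to[0,\infty)$ of finite support and capacity $\kappa_0>0$ is run as follows along a toppling sequence $(x^{(k)})_{k\ge1}$ in $\mathbb Z^d$. Start with $V_0=\operatorname{supp}\mu_0$ and the mass $\mu_0$. A site $x$ is unstable at time $k$ if either $x\in\partial V_k$ and $\mu_k(x)>\kappa_0$, or $x\in V_k\setminus\partial V_k$ and $\mu_k(x)>0$. If $x=x^{(k+1)}$ is unstable at time $k$, then $V_{k+1}=V_k\cup\{y:y\sim x\}$, and $\mu_{k+1}$ arises from $\mu_k$ by moving the whole mass of $x$ in equal parts to its $2d$ neighbours;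 otherwise $V_{k+1}=V_k$ and $\mu_{k+1}=\mu_k$. The sequence is infinitive if every site of $\mathbb Z^d$ occurs in it infinitely often, and the set of visited sites is then $V=\bigcup_{k\ge 0}V_k$. **Lemma.** For every $d\ge2$ there are constants $0<c_1<C_1$ and $N>1$, depending only on $d$, such that for every real $n\ge N$ and every infinitive toppling sequence, the set $V_n$ of visited sites of $\mathrm{BS}(n\delta_0,n^{1/d})$ (initial mass $n$ at the origin, capacity $n^{1/d}$) satisfies $$Z_{c_1n^{1/d}}\subset V_n\subset Z_{C_1n^{1/d}}.$$ -/

import Mathlib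

namespace BoundarySandpile

/-- The lattice `ℤ^d`. -/
abbrev Lattice (d : ℕ) : Type := Fin d → ℤ

/-- The Euclidean norm `|x|` of a lattice point. -/
noncomputable def enorm2 {d : ℕ} (x : Lattice d) : ℝ :=
  ‖(WithLp.toLp 2 (fun i => (x i : ℝ)) : EuclideanSpace ℝ (Fin d))‖

/-- Lattice neighbours: the `l¹`-distance of `x` and `y` is `1`. -/
def Neighbour {d : ℕ} (x y : Lattice d) : Prop := ∑ i, |x i - y i| = 1

/-- The boundary of `V`: the points of `V` which have a neighbour outside `V`. -/
def bdry {d : ℕ} (V : Set (Lattice d)) : Set (Lattice d) :=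
  {x | x ∈ V ∧ ∃ y, Neighbour y x ∧ y ∉ V}

/-- The interior of `V`. -/
def intr {d : ℕ} (V : Set (Lattice d)) : Set (Lattice d) := V \ bdry V

/-- The closed discrete ball `Z_R` of radius `R`, including its 1-neighbourhood. -/
def discBall (d : ℕ) (R : ℝ) : Set (Lattice d) :=
  {ξ | enorm2 ξ ≤ R} ∪ {x | ∃ ξ, Neighbour ξ x ∧ enorm2 ξ ≤ R ∧ R < enorm2 x}

/-- The data of the process at a given time: the set of visited sites, the distribution of mass,
and the odometer function. -/
structure State (d : ℕ) where
  visited : Set (Lattice d)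
  mass : Lattice d → ℝ
  odometer : Lattice d → ℝ

/-- The state at time `0` with initial distribution `μ₀`. -/
def initialState {d : ℕ} (μ₀ : Lattice d → ℝ) : State d where
  visited := Function.support μ₀
  mass := μ₀
  odometer := 0

/-- A site is unstable if it is a boundary point of the visited set with mass exceeding the
capacity `κ`, or an interior point of the visited set with positive mass. -/
def Unstable {d : ℕ} (κ : ℝ) (s : State d) (x : Lattice d) : Prop :=
  (x ∈ bdry s.visited ∧ κ < s.mass x) ∨ (x ∈ intr s.visited ∧ 0 < s.mass x)

open Classical in
/-- Toppling the site `x`: if `x` is unstable then all its mass is distributed equally among its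
`2d` neighbours, which become visited; if `x` is stable then nothing happens. -/
noncomputable def topple {d : ℕ} (κ : ℝ) (s : State d) (x : Lattice d) : State d :=
  if Unstable κ s x then
    { visited := s.visited ∪ {y | Neighbour y x}
      mass := fun y =>
        if y = x then 0
        else if Neighbour y x then s.mass y + 1 / (2 * (d : ℝ)) * s.mass x
        else s.mass y
      odometer := fun y => s.odometer y + if y = x then s.mass x else 0 }
  else s

/-- The boundary sandpile `BS(μ₀, κ)` run along the toppling sequence `T`: the state after the
first `k` topplings. -/
noncomputable def process {d : ℕ} (μ₀ : Lattice d → ℝ) (κ : ℝ) (T : ℕ → Lattice d) : ℕ → State d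
  | 0 => initialState μ₀
  | k + 1 => topple κ (process μ₀ κ T k) (T k)

/-- A toppling sequence is infinitive if every lattice point appears in it infinitely often. -/
def Infinitive {d : ℕ} (T : ℕ → Lattice d) : Prop := ∀ x, {k | T k = x}.Infinite

/-- The set of all sites visited by `BS(μ₀, κ)` along `T`. The visited sets increase in time, so
this is the final set of visited sites once they stop changing. -/
def visitedSites {d : ℕ} (μ₀ : Lattice d → ℝ) (κ : ℝ) (T : ℕ → Lattice d) : Set (Lattice d) :=
  ⋃ k, (process μ₀ κ T k).visited

/-- The distribution `n δ₀`: mass `n` concentrated at the origin. -/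
noncomputable def pointMass (d : ℕ) (n : ℝ) : Lattice d → ℝ := Pi.single 0 n

end BoundarySandpile

/-! Write `κ` for the capacity, so that the initial mass is `κ ^ d`. The mass at any time is the
initial mass plus the discrete Laplacian (`avg` minus identity) of the odometer (`mass_eq`), so both
inclusions are comparisons with radial functions `F (|x|² + b)`, where `F' s = -s ^ (-d/2)`. Up to
constants `F (|x|²)` is the Green kernel: `|x| ^ (2 - d)`, or a logarithm if `d = 2`. A large
positive shift `b` makes it superharmonic, and `b = -(d + 1)` makes it subharmonic far out.

Outer bound: a multiple of the superharmonic profile, cut off at radius `C * κ`, dominates the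
odometer (`exists_supersolution`, `process_le_supersolution`). Just outside the ball its average,
which bounds the mass there, is at most `κ`, so no site outside ever topples.

Inner bound: the odometers increase to a limit `u` (`exists_finalState`). Let `z` be an unvisited
site nearest to the origin, `r = |z|`. Every site closer to the origin is visited, so `u` is
superharmonic there with source `κ ^ d` at the origin, and the minimum principle puts it above a
multiple of `κ ^ d` times a subharmonic profile. A bounded number of steps inside from `z` this
gives `u ≥ ε * κ ^ d * r ^ (1 - d)`. On the other hand `u` grows at most geometrically along a path
leaving the unvisited set, so it is at most a constant times `κ` there. Hence `r` is at least of
order `κ` (`exists_inner_radius`). -/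

namespace BoundarySandpile

variable {d : ℕ}

/-! ### Lattice neighbours and the averaging operator. -/

/-- The average of `f` over the `2d` neighbours of `x`. -/
noncomputable def avg (f : Lattice d → ℝ) (x : Lattice d) : ℝ :=
  1 / (2 * (d : ℝ)) * ∑ i, (f (x + Pi.single i 1) + f (x - Pi.single i 1))

theorem neighbour_symm {x y : Lattice d} (h : Neighbour x y) : Neighbour y x := by
  unfold Neighbour at *
  rw [← h]
  exact Finset.sum_congr rfl fun i _ => abs_sub_comm _ _

theorem neighbour_add_single (x : Lattice d) (i : Fin d) :
    Neighbour (x + Pi.single i 1) x := by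
  unfold Neighbour
  rw [Finset.sum_eq_single i] <;> simp +contextual

theorem neighbour_sub_single (x : Lattice d) (i : Fin d) :
    Neighbour (x - Pi.single i 1) x := by
  unfold Neighbour
  rw [Finset.sum_eq_single i] <;> simp +contextual

theorem neighbour_iff {x y : Lattice d} :
    Neighbour y x ↔ ∃ i, y = x + Pi.single i 1 ∨ y = x - Pi.single i 1 := by
  constructor
  · intro h
    unfold Neighbour at h
    obtain ⟨i, hi⟩ : ∃ i, y i ≠ x i := by
      by_contra! hc
      simp [hc] at h
    rw [← Finset.add_sum_erase _ _ (Finset.mem_univ i)] at h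
    have hi1 : 1 ≤ |y i - x i| := Int.one_le_abs (sub_ne_zero.2 hi)
    have hs : 0 ≤ ∑ j ∈ Finset.univ.erase i, |y j - x j| :=
      Finset.sum_nonneg fun j _ => abs_nonneg _
    have h0 : ∑ j ∈ Finset.univ.erase i, |y j - x j| = 0 := by linarith
    have h1 : |y i - x i| = 1 := by linarith
    have hj : ∀ j, j ≠ i → y j = x j := by
      intro j hj
      have := (Finset.sum_eq_zero_iff_of_nonneg (fun j _ => abs_nonneg (y j - x j))).1 h0 j
        (by simp [hj])
      exact sub_eq_zero.1 (abs_eq_zero.1 this)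
    refine ⟨i, ?_⟩
    rcases (abs_eq zero_le_one).1 h1 with h | h
    · left
      ext j
      by_cases hji : j = i
      · subst hji; simp; linarith
      · simp [hji, hj j hji]
    · right
      ext j
      by_cases hji : j = i
      · subst hji; simp; linarith
      · simp [hji, hj j hji]
  · rintro ⟨i, rfl | rfl⟩
    · exact neighbour_add_single x i
    · exact neighbour_sub_single x i

theorem not_neighbour_self (x : Lattice d) : ¬ Neighbour x x := by simp [Neighbour]

theorem avg_mono {f g : Lattice d → ℝ} {x : Lattice d} (h : ∀ y, Neighbour y x → f y ≤ g y) :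
    avg f x ≤ avg g x := by
  unfold avg
  refine mul_le_mul_of_nonneg_left (Finset.sum_le_sum fun i _ => ?_) (by positivity)
  exact add_le_add (h _ (neighbour_add_single x i)) (h _ (neighbour_sub_single x i))

theorem avg_nonneg {f : Lattice d → ℝ} (h : ∀ y, 0 ≤ f y) (x : Lattice d) : 0 ≤ avg f x :=
  mul_nonneg (by positivity) (Finset.sum_nonneg fun i _ => add_nonneg (h _) (h _))

theorem avg_add (f g : Lattice d → ℝ) (x : Lattice d) :
    avg (fun y => f y + g y) x = avg f x + avg g x := by
  unfold avg
  rw [← mul_add, ← Finset.sum_add_distrib]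
  congr 1
  exact Finset.sum_congr rfl fun i _ => by ring

theorem avg_const_mul (c : ℝ) (f : Lattice d → ℝ) (x : Lattice d) :
    avg (fun y => c * f y) x = c * avg f x := by
  unfold avg
  rw [mul_left_comm]
  congr 1
  rw [Finset.mul_sum]
  exact Finset.sum_congr rfl fun i _ => by ring

theorem avg_const (hd : d ≠ 0) (c : ℝ) (x : Lattice d) : avg (fun _ => c) x = c := by
  unfold avg
  have : (d : ℝ) ≠ 0 := by exact_mod_cast hd
  simp
  field_simp
  ring

theorem avg_sub_const (hd : d ≠ 0) (f : Lattice d → ℝ) (c : ℝ) (x : Lattice d) :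
    avg (fun y => f y - c) x = avg f x - c := by
  have := avg_add f (fun _ => -c) x
  rw [avg_const hd] at this
  simpa [sub_eq_add_neg] using this

theorem avg_le (hd : d ≠ 0) {f : Lattice d → ℝ} {x : Lattice d} {c : ℝ}
    (h : ∀ y, Neighbour y x → f y ≤ c) : avg f x ≤ c :=
  (avg_mono h).trans_eq (avg_const hd c x)

theorem le_avg (hd : d ≠ 0) {f : Lattice d → ℝ} {x : Lattice d} {c : ℝ}
    (h : ∀ y, Neighbour y x → c ≤ f y) : c ≤ avg f x :=
  (avg_const hd c x).symm.trans_le (avg_mono h)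

theorem le_avg_of_neighbour {f : Lattice d → ℝ} (h : ∀ y, 0 ≤ f y) {x y : Lattice d}
    (hxy : Neighbour y x) : 1 / (2 * (d : ℝ)) * f y ≤ avg f x := by
  unfold avg
  refine mul_le_mul_of_nonneg_left ?_ (by positivity)
  obtain ⟨i, hi⟩ := neighbour_iff.1 hxy
  refine le_trans ?_ (Finset.single_le_sum
    (f := fun i => f (x + Pi.single i 1) + f (x - Pi.single i 1))
    (fun j _ => add_nonneg (h _) (h _)) (Finset.mem_univ i))
  rcases hi with rfl | rfl
  · exact le_add_of_nonneg_right (h _)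
  · exact le_add_of_nonneg_left (h _)

open Classical in
theorem avg_indicator (x : Lattice d) (m : ℝ) (y : Lattice d) :
    avg (fun z => if z = x then m else 0) y =
      if Neighbour y x then 1 / (2 * (d : ℝ)) * m else 0 := by
  split_ifs with h
  · unfold avg
    congr 1
    obtain ⟨i, hi⟩ := neighbour_iff.1 h
    have key : ∀ j, ((if y + Pi.single j 1 = x then m else 0) +
        (if y - Pi.single j 1 = x then m else 0)) = if j = i then m else 0 := by
      intro j
      -- Two unit steps return to `x` only along the same axis and in opposite directions, so
      -- exactly one of the `2d` summands is hit.
      have e1 : ∀ (j : Fin d) (s t : ℤ), s ≠ 0 →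
          x + Pi.single i s + Pi.single j t = x → j = i ∧ s + t = 0 := by
        intro j s t hs h
        have h2 := congrFun h i
        have h3 := congrFun h j
        by_cases hji : j = i
        · subst hji
          simp at h2
          exact ⟨rfl, by linarith⟩
        · simp [Ne.symm hji] at h2
          exact absurd h2 hs
      rcases hi with rfl | rfl
      · have n1 : x + Pi.single i 1 + Pi.single j 1 ≠ x := fun h => by
          have := (e1 j 1 1 one_ne_zero h).2
          norm_num at this
        rw [if_neg n1, zero_add]
        by_cases hji : j = i
        · subst hji; simp
        · rw [if_neg hji, if_neg]
          intro h
          refine hji (e1 j 1 (-1) one_ne_zero ?_).1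
          rwa [Pi.single_neg, ← sub_eq_add_neg]
      · have n1 : x - Pi.single i 1 - Pi.single j 1 ≠ x := fun h => by
          have := (e1 j (-1) (-1) (by norm_num) (by
            simpa [Pi.single_neg, sub_eq_add_neg] using h)).2
          norm_num at this
        rw [if_neg n1, add_zero]
        by_cases hji : j = i
        · subst hji; simp
        · rw [if_neg hji, if_neg]
          intro h
          refine hji (e1 j (-1) 1 (by norm_num) ?_).1
          rwa [Pi.single_neg, ← sub_eq_add_neg]
    rw [Finset.sum_congr rfl fun j _ => key j]
    simp
  · unfold avg
    rw [Finset.sum_eq_zero, mul_zero]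
    intro i _
    beta_reduce
    rw [if_neg, if_neg, add_zero]
    · rintro rfl
      exact h (neighbour_symm (neighbour_sub_single y i))
    · rintro rfl
      exact h (neighbour_symm (neighbour_add_single y i))

/-! ### Euclidean and `ℓ¹` norms on the lattice. -/

theorem enorm2_nonneg (x : Lattice d) : 0 ≤ enorm2 x := norm_nonneg _

theorem enorm2_sq (x : Lattice d) : enorm2 x ^ 2 = ∑ i, (x i : ℝ) ^ 2 := by
  simp [enorm2, EuclideanSpace.norm_sq_eq]

theorem enorm2_zero : enorm2 (0 : Lattice d) = 0 := by
  have := enorm2_sq (0 : Lattice d)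
  simpa using this

theorem enorm2_sq_add_single (x : Lattice d) (i : Fin d) (m : ℤ) :
    enorm2 (x + Pi.single i m) ^ 2 = enorm2 x ^ 2 + 2 * m * x i + m ^ 2 := by
  rw [enorm2_sq, enorm2_sq, ← Finset.add_sum_erase _ _ (Finset.mem_univ i),
    ← Finset.add_sum_erase _ (fun j => (x j : ℝ) ^ 2) (Finset.mem_univ i)]
  have : ∑ j ∈ Finset.univ.erase i, (((x + Pi.single i m : Lattice d) j : ℤ) : ℝ) ^ 2 =
      ∑ j ∈ Finset.univ.erase i, (x j : ℝ) ^ 2 := by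
    refine Finset.sum_congr rfl fun j hj => ?_
    simp [Finset.ne_of_mem_erase hj]
  rw [this]
  simp
  ring

theorem enorm2_sq_sub_single (x : Lattice d) (i : Fin d) :
    enorm2 (x - Pi.single i 1) ^ 2 = enorm2 x ^ 2 - 2 * x i + 1 := by
  have := enorm2_sq_add_single x i (-1)
  rw [Pi.single_neg, ← sub_eq_add_neg] at this
  rw [this]
  push_cast
  ring

theorem abs_coord_le_enorm2 (x : Lattice d) (i : Fin d) : |(x i : ℝ)| ≤ enorm2 x := by
  refine abs_le_of_sq_le_sq ?_ (enorm2_nonneg x)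
  rw [enorm2_sq]
  exact Finset.single_le_sum (f := fun i => (x i : ℝ) ^ 2) (fun _ _ => sq_nonneg _)
    (Finset.mem_univ i)

theorem enorm2_neighbour_le {x y : Lattice d} (h : Neighbour y x) : enorm2 y ≤ enorm2 x + 1 := by
  refine abs_le_of_sq_le_sq' ?_ (by linarith [enorm2_nonneg x]) |>.2
  obtain ⟨i, rfl | rfl⟩ := neighbour_iff.1 h
  · have := abs_le.1 (abs_coord_le_enorm2 x i)
    rw [enorm2_sq_add_single]
    push_cast
    nlinarith
  · have := abs_le.1 (abs_coord_le_enorm2 x i)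
    rw [enorm2_sq_sub_single]
    nlinarith

/-- A coordinate of maximal modulus. -/
theorem exists_max_coord (hd : d ≠ 0) (x : Lattice d) : ∃ i, ∀ j, |x j| ≤ |x i| := by
  have : Nonempty (Fin d) := ⟨⟨0, Nat.pos_of_ne_zero hd⟩⟩
  obtain ⟨i, -, hi⟩ := Finset.exists_max_image Finset.univ (fun i => |x i|) Finset.univ_nonempty
  exact ⟨i, fun j => hi j (Finset.mem_univ j)⟩

theorem enorm2_le_mul_max_coord {x : Lattice d} {i : Fin d} (hi : ∀ j, |x j| ≤ |x i|) :
    enorm2 x ≤ d * |(x i : ℝ)| := by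
  refine abs_le_of_sq_le_sq' ?_ (by positivity) |>.2
  have hd : (1 : ℝ) ≤ d := by exact_mod_cast (Fin.pos i)
  rw [enorm2_sq, mul_pow]
  calc ∑ j, (x j : ℝ) ^ 2 ≤ ∑ _j : Fin d, |(x i : ℝ)| ^ 2 := by
        refine Finset.sum_le_sum fun j _ => ?_
        rw [← sq_abs]
        have : |(x j : ℝ)| ≤ |(x i : ℝ)| := by exact_mod_cast hi j
        gcongr
    _ = d * |(x i : ℝ)| ^ 2 := by simp
    _ ≤ d ^ 2 * |(x i : ℝ)| ^ 2 := by
        gcongr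
        nlinarith

/-- The `ℓ¹` norm. -/
def norm1 (x : Lattice d) : ℕ := ∑ i, (x i).natAbs

theorem norm1_cast (x : Lattice d) : (norm1 x : ℝ) = ∑ i, |(x i : ℝ)| := by
  simp [norm1]

theorem enorm2_le_norm1 (x : Lattice d) : enorm2 x ≤ norm1 x := by
  refine abs_le_of_sq_le_sq' ?_ (by positivity) |>.2
  rw [enorm2_sq, norm1_cast]
  calc ∑ j, (x j : ℝ) ^ 2 = ∑ j, |(x j : ℝ)| ^ 2 := by simp
    _ ≤ _ := Finset.sum_sq_le_sq_sum_of_nonneg fun i _ => abs_nonneg _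

theorem norm1_le_mul_enorm2 (x : Lattice d) : (norm1 x : ℝ) ≤ d * enorm2 x := by
  rw [norm1_cast]
  calc ∑ i, |(x i : ℝ)| ≤ ∑ _i : Fin d, enorm2 x :=
        Finset.sum_le_sum fun i _ => abs_coord_le_enorm2 x i
    _ = _ := by simp

theorem norm1_eq_zero {x : Lattice d} : norm1 x = 0 ↔ x = 0 := by
  simp [norm1, funext_iff]

theorem exists_neighbour_norm1 {x : Lattice d} (hx : x ≠ 0) :
    ∃ y, Neighbour y x ∧ norm1 y + 1 = norm1 x := by
  obtain ⟨i, hi⟩ : ∃ i, x i ≠ 0 := by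
    by_contra! hc
    exact hx (funext hc)
  have key : ∀ y : Lattice d, (∀ j, j ≠ i → y j = x j) → (y i).natAbs + 1 = (x i).natAbs →
      norm1 y + 1 = norm1 x := by
    intro y h1 h2
    unfold norm1
    rw [← Finset.add_sum_erase _ _ (Finset.mem_univ i),
      ← Finset.add_sum_erase _ (fun j => (x j).natAbs) (Finset.mem_univ i),
      Finset.sum_congr rfl fun j hj => by rw [h1 j (Finset.ne_of_mem_erase hj)]]
    omega
  rcases lt_or_gt_of_ne hi with h | h
  · refine ⟨x + Pi.single i 1, neighbour_add_single x i, key _ (fun j hj => by simp [hj]) ?_⟩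
    simp
    omega
  · refine ⟨x - Pi.single i 1, neighbour_sub_single x i, key _ (fun j hj => by simp [hj]) ?_⟩
    simp
    omega

theorem finite_enorm2_le (R : ℝ) : {x : Lattice d | enorm2 x ≤ R}.Finite := by
  refine (Set.Finite.pi' (t := fun _ : Fin d => Set.Icc (-⌈R⌉) ⌈R⌉)
    fun _ => Set.finite_Icc _ _).subset fun x hx i => ?_
  have h : |(x i : ℝ)| ≤ ⌈R⌉ := (abs_coord_le_enorm2 x i).trans (le_trans hx (Int.le_ceil R))
  have h' : |x i| ≤ ⌈R⌉ := by exact_mod_cast h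
  exact abs_le.1 h'

/-- A site outside the Euclidean ball of radius `R` has a neighbour outside `Z_R`. -/
theorem exists_neighbour_not_mem_discBall (hd : d ≠ 0) {R : ℝ} (hR : 0 ≤ R) {x : Lattice d}
    (hx : R < enorm2 x) : ∃ y, Neighbour y x ∧ y ∉ discBall d R := by
  obtain ⟨i, hi⟩ := exists_max_coord hd x
  -- Push `x` outwards along its largest coordinate to get `y`. One step back lowers `|y|²` by at
  -- most `2 (|x i| + 1) - 1`, hence not below `|x|²`, so no neighbour of `y` lies in the ball.
  have main : ∀ y : Lattice d, enorm2 y ^ 2 = enorm2 x ^ 2 + 2 * |(x i : ℝ)| + 1 →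
      (∀ j, |(y j : ℝ)| ≤ |(x i : ℝ)| + 1) → y ∉ discBall d R := by
    intro y hy hj hmem
    have hxR : R ^ 2 < enorm2 x ^ 2 := by gcongr
    rcases hmem with h | ⟨ξ, hξ, hξR, -⟩
    · have : enorm2 y ^ 2 ≤ R ^ 2 := by
        have := enorm2_nonneg y
        gcongr
        exact h
      have := abs_nonneg (x i : ℝ)
      linarith
    · have h1 : enorm2 ξ ^ 2 ≤ R ^ 2 := by
        have := enorm2_nonneg ξ
        gcongr
      obtain ⟨j, rfl | rfl⟩ := neighbour_iff.1 hξ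
      · rw [enorm2_sq_add_single] at h1
        have := (abs_le.1 (hj j)).1
        push_cast at h1
        linarith
      · rw [enorm2_sq_sub_single] at h1
        have := (abs_le.1 (hj j)).2
        linarith
  have hi' : ∀ j, |(x j : ℝ)| ≤ |(x i : ℝ)| := fun j => by exact_mod_cast hi j
  rcases le_total 0 (x i) with h | h
  · have h' : (0 : ℝ) ≤ x i := by exact_mod_cast h
    refine ⟨_, neighbour_add_single x i, main _ ?_ fun j => ?_⟩
    · rw [enorm2_sq_add_single, abs_of_nonneg h']
      push_cast
      ring
    · by_cases hji : j = i
      · subst hji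
        simpa using abs_add_le (x j : ℝ) 1
      · simpa [hji] using (hi' j).trans (by linarith)
  · have h' : (x i : ℝ) ≤ 0 := by exact_mod_cast h
    refine ⟨_, neighbour_sub_single x i, main _ ?_ fun j => ?_⟩
    · rw [enorm2_sq_sub_single, abs_of_nonpos h']
      ring
    · by_cases hji : j = i
      · subst hji
        simpa using abs_sub (x j : ℝ) 1
      · simpa [hji] using (hi' j).trans (by linarith)

/-! ### Mass, odometer and visited set along the process. -/

section Dynamics

variable {n κ : ℝ} {T : ℕ → Lattice d}

theorem visited_subset_topple (s : State d) (x : Lattice d) :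
    s.visited ⊆ (topple κ s x).visited := by
  unfold topple
  split_ifs
  · exact Set.subset_union_left
  · exact subset_rfl

theorem visited_monotone (μ₀ : Lattice d → ℝ) (κ : ℝ) (T : ℕ → Lattice d) :
    Monotone fun k => (process μ₀ κ T k).visited :=
  monotone_nat_of_le_succ fun k => visited_subset_topple (process μ₀ κ T k) (T k)

/-- Each toppling adds a point mass to the odometer and changes the mass by its Laplacian
(`avg_indicator`), so the relation is independent of the order of topplings. -/
theorem mass_eq (μ₀ : Lattice d → ℝ) (κ : ℝ) (T : ℕ → Lattice d) (k : ℕ) (x : Lattice d) :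
    (process μ₀ κ T k).mass x =
      μ₀ x + avg (process μ₀ κ T k).odometer x - (process μ₀ κ T k).odometer x := by
  induction k generalizing x with
  | zero => simp [process, initialState, avg]
  | succ k ih =>
    set s := process μ₀ κ T k with hs
    change (topple κ s (T k)).mass x =
      μ₀ x + avg (topple κ s (T k)).odometer x - (topple κ s (T k)).odometer x
    unfold topple
    split_ifs with hu
    · simp only
      rw [avg_add, avg_indicator]
      by_cases hx : x = T k
      · subst hx
        simp [not_neighbour_self]
        linarith [ih (T k)]
      · simp only [hx, if_false]
        split_ifs
        · linarith [ih x]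
        · linarith [ih x]
    · exact ih x

theorem odometer_topple_of_unstable {s : State d} {x : Lattice d} (h : Unstable κ s x) :
    (topple κ s x).odometer x = s.odometer x + s.mass x := by
  simp [topple, h]

theorem odometer_topple_of_ne {s : State d} {x y : Lattice d} (h : y ≠ x) :
    (topple κ s x).odometer y = s.odometer y := by
  unfold topple
  split_ifs <;> simp [h]

theorem Unstable.mem {s : State d} {x : Lattice d} (h : Unstable κ s x) : x ∈ s.visited := by
  rcases h with h | h
  · exact h.1.1
  · exact h.1.1

theorem Unstable.mass_pos (hκ : 0 ≤ κ) {s : State d} {x : Lattice d} (h : Unstable κ s x) :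
    0 < s.mass x := by
  rcases h with h | h
  · exact hκ.trans_lt h.2
  · exact h.2

theorem odometer_monotone (hκ : 0 ≤ κ) (μ₀ : Lattice d → ℝ) (T : ℕ → Lattice d)
    (x : Lattice d) : Monotone fun k => (process μ₀ κ T k).odometer x := by
  refine monotone_nat_of_le_succ fun k => ?_
  change (process μ₀ κ T k).odometer x ≤ (topple κ (process μ₀ κ T k) (T k)).odometer x
  by_cases hx : x = T k
  · by_cases hu : Unstable κ (process μ₀ κ T k) (T k)
    · subst hx
      rw [odometer_topple_of_unstable hu]
      linarith [hu.mass_pos hκ]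
    · simp [topple, hu]
  · rw [odometer_topple_of_ne hx]

theorem odometer_nonneg (hκ : 0 ≤ κ) (μ₀ : Lattice d → ℝ) (T : ℕ → Lattice d) (k : ℕ)
    (x : Lattice d) : 0 ≤ (process μ₀ κ T k).odometer x :=
  odometer_monotone hκ μ₀ T x (Nat.zero_le k)

/-- Sites which have toppled have all their neighbours visited. -/
theorem neighbour_mem_of_odometer_pos (μ₀ : Lattice d → ℝ) (κ : ℝ) (T : ℕ → Lattice d) (k : ℕ)
    {x : Lattice d} (h : 0 < (process μ₀ κ T k).odometer x) :
    x ∈ (process μ₀ κ T k).visited ∧ ∀ y, Neighbour y x → y ∈ (process μ₀ κ T k).visited := by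
  induction k with
  | zero => simp [process, initialState] at h
  | succ k ih =>
    set s := process μ₀ κ T k with hs
    change 0 < (topple κ s (T k)).odometer x at h
    change x ∈ (topple κ s (T k)).visited ∧ ∀ y, Neighbour y x → y ∈ (topple κ s (T k)).visited
    have hsub := visited_subset_topple (κ := κ) s (T k)
    by_cases hx : 0 < s.odometer x
    · exact ⟨hsub (ih hx).1, fun y hy => hsub ((ih hx).2 y hy)⟩
    · by_cases hxT : x = T k
      · by_cases hu : Unstable κ s (T k)
        · subst hxT
          refine ⟨hsub hu.mem, fun y hy => ?_⟩
          simp only [topple, hu, if_true]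
          exact Or.inr hy
        · simp only [topple, hu, if_false] at h
          exact absurd h hx
      · rw [odometer_topple_of_ne hxT] at h
        exact absurd h hx

/-- Comparison with a supersolution on a ball. -/
theorem process_le_supersolution (hd : d ≠ 0) (hκ : 0 ≤ κ) {μ₀ : Lattice d → ℝ} {R : ℝ}
    (hR : 0 ≤ R) {w : Lattice d → ℝ} (hw : ∀ x, 0 ≤ w x)
    (hμ : ∀ x, R < enorm2 x → μ₀ x = 0)
    (hin : ∀ x, enorm2 x ≤ R → μ₀ x + avg w x ≤ w x)
    (hout : ∀ x, R < enorm2 x → w x = 0 ∧ avg w x ≤ κ) (T : ℕ → Lattice d) (k : ℕ) :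
    (∀ x, (process μ₀ κ T k).odometer x ≤ w x) ∧ (process μ₀ κ T k).visited ⊆ discBall d R := by
  induction k with
  | zero =>
    refine ⟨hw, fun x hx => Or.inl ?_⟩
    by_contra hc
    exact hx (hμ x (not_le.1 hc))
  | succ k ih =>
    have hmass := mass_eq μ₀ κ T k (T k)
    have hnn := odometer_nonneg hκ μ₀ T k
    set s := process μ₀ κ T k with hs
    change (∀ x, (topple κ s (T k)).odometer x ≤ w x) ∧
      (topple κ s (T k)).visited ⊆ discBall d R
    by_cases hu : Unstable κ s (T k)
    · have havg : avg s.odometer (T k) ≤ avg w (T k) := avg_mono fun y _ => ih.1 y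
      -- A site outside the ball has a neighbour outside `Z_R`, so it cannot be interior; as a
      -- boundary site its mass is at most `avg w ≤ κ`.
      have hball : enorm2 (T k) ≤ R := by
        by_contra! hc
        obtain ⟨h0, h1⟩ := hout _ hc
        rcases hu with ⟨-, hu⟩ | ⟨hu, -⟩
        · have := hnn (T k)
          rw [hmass, hμ _ hc] at hu
          linarith
        · obtain ⟨y, hy, hyR⟩ := exists_neighbour_not_mem_discBall hd hR hc
          exact hu.2 ⟨hu.1, y, hy, fun h => hyR (ih.2 h)⟩
      constructor
      · intro x
        by_cases hx : x = T k
        · subst hx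
          -- Since the whole mass leaves, the new odometer value is `μ₀ + avg odometer`; the old
          -- value cancels.
          rw [odometer_topple_of_unstable hu, hmass]
          linarith [hin _ hball]
        · rw [odometer_topple_of_ne hx]
          exact ih.1 x
      · simp only [topple, hu, if_true]
        refine Set.union_subset ih.2 fun y hy => ?_
        by_cases hyR : enorm2 y ≤ R
        · exact Or.inl hyR
        · exact Or.inr ⟨T k, neighbour_symm hy, hball, not_le.1 hyR⟩
    · simpa only [topple, hu, if_false] using ih

end Dynamics

/-! ### The limiting odometer. -/

/-- The properties of the final odometer `u` and of the final set `V` of visited sites that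
determine the inner radius. -/
structure FinalState (μ₀ : Lattice d → ℝ) (κ : ℝ) (V : Set (Lattice d)) (u : Lattice d → ℝ) :
    Prop where
  nonneg : ∀ x, 0 ≤ u x
  mem_of_pos : ∀ x, 0 < u x → x ∈ V ∧ ∀ y, Neighbour y x → y ∈ V
  le_of_interior : ∀ x ∈ V, (∀ y, Neighbour y x → y ∈ V) → μ₀ x + avg u x ≤ u x
  le_of_mem : ∀ x ∈ V, μ₀ x + avg u x ≤ max κ (u x)

-- The odometer is monotone and bounded by `w`, so it converges, and with it the mass. Along the
-- infinitely many visits to `x` the mass is at most `0` just after the visit if `x` is eventually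
-- interior. If `x` keeps an unvisited neighbour it never topples, so its mass is at most `κ` at
-- each late visit. Both bounds pass to the limit.
open Filter Topology in
theorem exists_finalState {κ : ℝ} (hκ : 0 ≤ κ) {μ₀ : Lattice d → ℝ} {T : ℕ → Lattice d}
    (hT : Infinitive T) {w : Lattice d → ℝ}
    (hw : ∀ k x, (process μ₀ κ T k).odometer x ≤ w x) :
    ∃ u, FinalState μ₀ κ (visitedSites μ₀ κ T) u := by
  set s := process μ₀ κ T with hs
  have hlim : ∀ x, ∃ l, Tendsto (fun k => (s k).odometer x) atTop (𝓝 l) := fun x =>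
    ⟨_, tendsto_atTop_ciSup (odometer_monotone hκ μ₀ T x) ⟨w x, by rintro _ ⟨k, rfl⟩; exact hw k x⟩⟩
  choose u hu using hlim
  have hnn : ∀ x, 0 ≤ u x := fun x =>
    ge_of_tendsto' (hu x) fun k => odometer_nonneg hκ μ₀ T k x
  have hpos : ∀ x, 0 < u x → x ∈ visitedSites μ₀ κ T ∧
      ∀ y, Neighbour y x → y ∈ visitedSites μ₀ κ T := by
    intro x hx
    obtain ⟨k, hk⟩ := ((hu x).eventually (lt_mem_nhds hx)).exists
    have := neighbour_mem_of_odometer_pos μ₀ κ T k hk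
    exact ⟨Set.mem_iUnion.2 ⟨k, this.1⟩, fun y hy => Set.mem_iUnion.2 ⟨k, this.2 y hy⟩⟩
  have hmass : ∀ x, Tendsto (fun k => (s k).mass x) atTop (𝓝 (μ₀ x + avg u x - u x)) := by
    intro x
    simp_rw [hs, mass_eq]
    refine (tendsto_const_nhds.add ?_).sub (hu x)
    unfold avg
    exact tendsto_const_nhds.mul (tendsto_finsetSum _ fun i _ => (hu _).add (hu _))
  have hvis : ∀ x ∈ visitedSites μ₀ κ T, ∀ᶠ k in atTop, x ∈ (s k).visited := by
    intro x hx
    obtain ⟨k, hk⟩ := Set.mem_iUnion.1 hx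
    exact eventually_atTop.2 ⟨k, fun j hj => visited_monotone μ₀ κ T hj hk⟩
  have hint : ∀ x ∈ visitedSites μ₀ κ T, (∀ y, Neighbour y x → y ∈ visitedSites μ₀ κ T) →
      μ₀ x + avg u x ≤ u x := by
    intro x hx hxn
    have hev : ∀ᶠ k in atTop, x ∈ intr (s k).visited := by
      have h1 : ∀ᶠ k in atTop, ∀ i : Fin d, x + Pi.single i 1 ∈ (s k).visited :=
        eventually_all.2 fun i => hvis _ (hxn _ (neighbour_add_single x i))
      have h2 : ∀ᶠ k in atTop, ∀ i : Fin d, x - Pi.single i 1 ∈ (s k).visited :=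
        eventually_all.2 fun i => hvis _ (hxn _ (neighbour_sub_single x i))
      filter_upwards [hvis x hx, h1, h2] with k h0 h1 h2
      refine ⟨h0, ?_⟩
      rintro ⟨-, y, hy, hyn⟩
      obtain ⟨i, rfl | rfl⟩ := neighbour_iff.1 hy
      · exact hyn (h1 i)
      · exact hyn (h2 i)
    have hfr : ∃ᶠ k in atTop, (s (k + 1)).mass x ≤ 0 := by
      refine ((Nat.frequently_atTop_iff_infinite.2 (hT x)).and_eventually hev).mono ?_
      rintro k ⟨rfl, hk⟩
      change (topple κ (s k) (T k)).mass (T k) ≤ 0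
      unfold topple
      split_ifs with h
      · simp
      · by_contra! hc
        exact h (Or.inr ⟨hk, hc⟩)
    have := le_of_tendsto_of_frequently ((hmass x).comp (tendsto_add_atTop_nat 1)) hfr
    linarith
  refine ⟨u, hnn, hpos, hint, fun x hx => ?_⟩
  by_cases hxn : ∀ y, Neighbour y x → y ∈ visitedSites μ₀ κ T
  · exact (hint x hx hxn).trans (le_max_right _ _)
  · have hux : u x = 0 := le_antisymm (not_lt.1 fun h => hxn (hpos x h).2) (hnn x)
    push Not at hxn
    obtain ⟨y, hy, hyn⟩ := hxn
    have hyk : ∀ k, y ∉ (s k).visited := fun k h => hyn (Set.mem_iUnion.2 ⟨k, h⟩)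
    have hfr : ∃ᶠ k in atTop, (s k).mass x ≤ κ := by
      refine ((Nat.frequently_atTop_iff_infinite.2 (hT x)).and_eventually (hvis x hx)).mono ?_
      rintro k ⟨rfl, hk⟩
      by_contra! hc
      have hun : Unstable κ (s k) (T k) := Or.inl ⟨⟨hk, y, hy, hyk k⟩, hc⟩
      refine hyk (k + 1) ?_
      change y ∈ (topple κ (s k) (T k)).visited
      simp only [topple, hun, if_true]
      exact Or.inr hy
    have := le_of_tendsto_of_frequently (hmass x) hfr
    refine le_trans ?_ (le_max_left _ _)
    linarith

/-! ### One-variable estimates for the radial profile. -/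

theorem exists_primitive_rpow (p : ℝ) : ∃ F : ℝ → ℝ, ∀ s, 0 < s → HasDerivAt F (-s ^ (-p)) s := by
  by_cases hp : p = 1
  · refine ⟨fun s => -Real.log s, fun s hs => ?_⟩
    have := (Real.hasDerivAt_log hs.ne').neg
    rwa [hp, Real.rpow_neg_one]
  · have hp' : 1 - p ≠ 0 := sub_ne_zero.2 (Ne.symm hp)
    refine ⟨fun s => -(1 - p)⁻¹ * s ^ (1 - p), fun s hs => ?_⟩
    have := (Real.hasDerivAt_rpow_const (p := 1 - p) (Or.inl hs.ne')).const_mul (-(1 - p)⁻¹)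
    refine this.congr_deriv ?_
    rw [show 1 - p - 1 = -p by ring]
    field_simp

theorem nonneg_of_hasDerivAt_nonneg {k k' : ℝ → ℝ} {b : ℝ}
    (hk : ∀ y, 0 ≤ y → y ≤ b → HasDerivAt k (k' y) y) (h0 : k 0 = 0)
    (hk' : ∀ y, 0 ≤ y → y ≤ b → 0 ≤ k' y) {y : ℝ} (hy : 0 ≤ y) (hyb : y ≤ b) : 0 ≤ k y := by
  have hm : MonotoneOn k (Set.Icc 0 b) := by
    refine monotoneOn_of_deriv_nonneg (convex_Icc 0 b)
      (fun x hx => (hk x hx.1 hx.2).continuousAt.continuousWithinAt)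
      (fun x hx => ?_) (fun x hx => ?_)
    · rw [interior_Icc] at hx
      exact (hk x hx.1.le hx.2.le).differentiableAt.differentiableWithinAt
    · rw [interior_Icc] at hx
      rw [(hk x hx.1.le hx.2.le).deriv]
      exact hk' x hx.1.le hx.2.le
  rw [← h0]
  exact hm ⟨le_rfl, hy.trans hyb⟩ ⟨hy, hyb⟩ hy

theorem hasDerivAt_one_sub_rpow (m y : ℝ) (hy : y < 1) :
    HasDerivAt (fun y : ℝ => (1 - y) ^ (-m)) (m * (1 - y) ^ (-(m + 1))) y := by
  have := ((hasDerivAt_id y).const_sub 1).rpow_const (p := -m) (Or.inl (by simp; linarith))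
  refine this.congr_deriv ?_
  rw [show -m - 1 = -(m + 1) by ring]
  simp

theorem hasDerivAt_one_add_rpow (m y : ℝ) (hy : -1 < y) :
    HasDerivAt (fun y : ℝ => (1 + y) ^ (-m)) (-(m * (1 + y) ^ (-(m + 1)))) y := by
  have := ((hasDerivAt_id y).const_add 1).rpow_const (p := -m) (Or.inl (by simp; linarith))
  refine this.congr_deriv ?_
  rw [show -m - 1 = -(m + 1) by ring]
  simp

/-- Third order upper bound for the odd part of `(1 - y)^{-p}`. -/
theorem one_sub_rpow_sub_le {p : ℝ} (hp : 0 ≤ p) : ∃ C : ℝ, 0 ≤ C ∧ ∀ y : ℝ, 0 ≤ y → y ≤ 1 / 2 →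
    (1 - y) ^ (-p) - (1 + y) ^ (-p) ≤ 2 * p * y + C * y ^ 3 := by
  -- `M` bounds the third derivative of the left side on `[0, 1/2]`; `s3`, `s2`, `s1` integrate this
  -- bound back up.
  obtain ⟨M, hM⟩ : ∃ M : ℝ, M = p * ((p + 1) * ((p + 2) * (2 ^ (p + 3) + 1))) := ⟨_, rfl⟩
  have hM0 : 0 ≤ M := by rw [hM]; positivity
  refine ⟨M / 6, by positivity, ?_⟩
  have s3 : ∀ y : ℝ, 0 ≤ y → y ≤ 1 / 2 →
      0 ≤ M - p * ((p + 1) * ((p + 2) * ((1 - y) ^ (-(p + 3)) + (1 + y) ^ (-(p + 3))))) := by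
    intro y hy hy2
    have h1 : (1 - y) ^ (-(p + 3)) ≤ 2 ^ (p + 3) := by
      have : (1 - y) ^ (-(p + 3)) ≤ (1 / 2 : ℝ) ^ (-(p + 3)) :=
        Real.rpow_le_rpow_of_nonpos (by norm_num) (by linarith) (by linarith)
      rwa [one_div, Real.inv_rpow (by norm_num), ← Real.rpow_neg (by norm_num), neg_neg] at this
    have h2 : (1 + y) ^ (-(p + 3)) ≤ 1 :=
      Real.rpow_le_one_of_one_le_of_nonpos (by linarith) (by linarith)
    rw [hM, sub_nonneg]
    gcongr
  have s2 : ∀ y : ℝ, 0 ≤ y → y ≤ 1 / 2 →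
      0 ≤ M * y - p * ((p + 1) * ((1 - y) ^ (-(p + 2)) - (1 + y) ^ (-(p + 2)))) := by
    intro y hy hy2
    refine nonneg_of_hasDerivAt_nonneg (b := 1 / 2) (k := fun y =>
      M * y - p * ((p + 1) * ((1 - y) ^ (-(p + 2)) - (1 + y) ^ (-(p + 2)))))
      (fun y hy hy2 => ?_) (by simp) s3 hy hy2
    have a := hasDerivAt_one_sub_rpow (p + 2) y (by linarith)
    have b := hasDerivAt_one_add_rpow (p + 2) y (by linarith)
    refine HasDerivAt.congr_deriv (((hasDerivAt_id y).const_mul M).sub (((a.sub b).const_mul (p + 1)).const_mul p)) ?_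
    rw [show p + 2 + 1 = p + 3 by ring]
    ring
  have s1 : ∀ y : ℝ, 0 ≤ y → y ≤ 1 / 2 →
      0 ≤ M / 2 * y ^ 2 + 2 * p - p * ((1 - y) ^ (-(p + 1)) + (1 + y) ^ (-(p + 1))) := by
    intro y hy hy2
    refine nonneg_of_hasDerivAt_nonneg (b := 1 / 2) (k := fun y =>
      M / 2 * y ^ 2 + 2 * p - p * ((1 - y) ^ (-(p + 1)) + (1 + y) ^ (-(p + 1))))
      (fun y hy hy2 => ?_) (by simp; ring) s2 hy hy2
    have a := hasDerivAt_one_sub_rpow (p + 1) y (by linarith)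
    have b := hasDerivAt_one_add_rpow (p + 1) y (by linarith)
    refine HasDerivAt.congr_deriv ((((hasDerivAt_pow 2 y).const_mul (M / 2)).add_const (2 * p)).sub
      ((a.add b).const_mul p)) ?_
    rw [show p + 1 + 1 = p + 2 by ring]
    push_cast
    ring
  intro y hy hy2
  have := nonneg_of_hasDerivAt_nonneg (b := 1 / 2) (k := fun y =>
      M / 6 * y ^ 3 + 2 * p * y - ((1 - y) ^ (-p) - (1 + y) ^ (-p)))
      (fun y hy hy2 => ?_) (by simp) s1 hy hy2
  · linarith
  · have a := hasDerivAt_one_sub_rpow p y (by linarith)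
    have b := hasDerivAt_one_add_rpow p y (by linarith)
    refine HasDerivAt.congr_deriv ((((hasDerivAt_pow 3 y).const_mul (M / 6)).add
      ((hasDerivAt_id y).const_mul (2 * p))).sub (a.sub b)) ?_
    push_cast
    ring

/-- After differentiating, this is AM-GM: the two powers have product `(1 - z²) ^ (-(p + 1)) ≥ 1`,
so their sum is at least `2`. -/
theorem le_one_sub_rpow_sub {p : ℝ} (hp : 0 ≤ p) {y : ℝ} (hy : 0 ≤ y) (hy1 : y < 1) :
    2 * p * y ≤ (1 - y) ^ (-p) - (1 + y) ^ (-p) := by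
  have h := nonneg_of_hasDerivAt_nonneg (b := y) (k := fun y =>
      ((1 - y) ^ (-p) - (1 + y) ^ (-p)) - 2 * p * y)
      (k' := fun y => p * ((1 - y) ^ (-(p + 1)) + (1 + y) ^ (-(p + 1))) - 2 * p)
      (fun z hz hzy => ?_) (by simp) (fun z hz hzy => ?_) hy le_rfl
  · linarith
  · have a := hasDerivAt_one_sub_rpow p z (by linarith)
    have b := hasDerivAt_one_add_rpow p z (by linarith)
    refine HasDerivAt.congr_deriv ((a.sub b).sub ((hasDerivAt_id z).const_mul (2 * p))) ?_
    ring
  · have hz1 : 0 < 1 - z := by linarith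
    have hz2 : 0 < 1 + z := by linarith
    have key : 2 ≤ (1 - z) ^ (-(p + 1)) + (1 + z) ^ (-(p + 1)) := by
      set α := (1 - z) ^ (-(p + 1)) with hα
      set β := (1 + z) ^ (-(p + 1)) with hβ
      have hα0 : 0 < α := Real.rpow_pos_of_pos hz1 _
      have hβ0 : 0 < β := Real.rpow_pos_of_pos hz2 _
      have hαβ : 1 ≤ α * β := by
        rw [hα, hβ, ← Real.mul_rpow hz1.le hz2.le]
        exact Real.one_le_rpow_of_pos_of_le_one_of_nonpos (by positivity) (by nlinarith)
          (by linarith)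
      nlinarith [sq_nonneg (α - β)]
    nlinarith

section Primitive

variable {F : ℝ → ℝ} {p : ℝ}

theorem primitive_sub_bounds (hp : 0 ≤ p) (hF : ∀ s, 0 < s → HasDerivAt F (-s ^ (-p)) s) {s t : ℝ}
    (hs : 0 < s) (hst : s ≤ t) :
    (t - s) * t ^ (-p) ≤ F s - F t ∧ F s - F t ≤ (t - s) * s ^ (-p) := by
  rcases hst.eq_or_lt with rfl | hlt
  · simp
  · obtain ⟨c, hc, hc'⟩ := exists_hasDerivAt_eq_slope F (fun s => -s ^ (-p)) hlt
      (fun x hx => (hF x (hs.trans_le hx.1)).continuousAt.continuousWithinAt)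
      (fun x hx => hF x (hs.trans hx.1))
    have hts : 0 < t - s := sub_pos.2 hlt
    rw [eq_div_iff hts.ne'] at hc'
    have h1 : t ^ (-p) ≤ c ^ (-p) :=
      Real.rpow_le_rpow_of_nonpos (hs.trans hc.1) hc.2.le (by linarith)
    have h2 : c ^ (-p) ≤ s ^ (-p) := Real.rpow_le_rpow_of_nonpos hs hc.1.le (by linarith)
    constructor <;> nlinarith

theorem primitive_antitone (hp : 0 ≤ p) (hF : ∀ s, 0 < s → HasDerivAt F (-s ^ (-p)) s) {s t : ℝ}
    (hs : 0 < s) (hst : s ≤ t) : F t ≤ F s := by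
  have h := (primitive_sub_bounds hp hF hs hst).1
  have : 0 ≤ (t - s) * t ^ (-p) :=
    mul_nonneg (sub_nonneg.2 hst) (Real.rpow_nonneg (hs.le.trans hst) _)
  linarith

theorem hasDerivAt_second_difference (hF : ∀ s, 0 < s → HasDerivAt F (-s ^ (-p)) s) {A h : ℝ}
    (hh : 0 ≤ h) (hA : h < A) :
    HasDerivAt (fun h => F (A + h) + F (A - h) - 2 * F A)
      (A ^ (-p) * ((1 - h / A) ^ (-p) - (1 + h / A) ^ (-p))) h := by
  have hA0 : 0 < A := hh.trans_lt hA
  have a := (hF (A + h) (by linarith)).comp h ((hasDerivAt_id h).const_add A)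
  have b := (hF (A - h) (by linarith)).comp h ((hasDerivAt_id h).const_sub A)
  refine HasDerivAt.congr_deriv ((a.add b).sub_const (2 * F A)) ?_
  have e1 : A + h = A * (1 + h / A) := by field_simp
  have e2 : A - h = A * (1 - h / A) := by field_simp
  have h1 : 0 ≤ 1 - h / A := by
    rw [sub_nonneg, div_le_one hA0]
    exact hA.le
  rw [e1, e2, Real.mul_rpow hA0.le (by positivity), Real.mul_rpow hA0.le h1]
  ring

theorem second_difference_le (hF : ∀ s, 0 < s → HasDerivAt F (-s ^ (-p)) s)
    {C : ℝ} (hC : ∀ y : ℝ, 0 ≤ y → y ≤ 1 / 2 →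
      (1 - y) ^ (-p) - (1 + y) ^ (-p) ≤ 2 * p * y + C * y ^ 3) {A h : ℝ} (hA : 0 < A)
    (hh : |h| ≤ A / 2) :
    F (A + h) + F (A - h) - 2 * F A ≤ A ^ (-p) * (p * h ^ 2 / A + C / 4 * h ^ 4 / A ^ 3) := by
  wlog h0 : 0 ≤ h generalizing h
  · have := this (h := -h) (by rwa [abs_neg]) (by linarith)
    simp only [sub_neg_eq_add, even_two.neg_pow, (show Even 4 by decide).neg_pow] at this
    rw [← sub_eq_add_neg] at this
    linarith
  rw [abs_of_nonneg h0] at hh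
  have := nonneg_of_hasDerivAt_nonneg (b := A / 2)
    (k := fun h => A ^ (-p) * (p * h ^ 2 / A + C / 4 * h ^ 4 / A ^ 3) -
      (F (A + h) + F (A - h) - 2 * F A))
    (k' := fun h => A ^ (-p) * (2 * p * (h / A) + C * (h / A) ^ 3) -
      A ^ (-p) * ((1 - h / A) ^ (-p) - (1 + h / A) ^ (-p)))
    (fun y hy hyA => ?_) (by simp; ring) (fun y hy hyA => ?_) h0 hh
  · linarith
  · refine HasDerivAt.sub ?_ (hasDerivAt_second_difference hF hy (by linarith))
    refine HasDerivAt.congr_deriv (((((hasDerivAt_pow 2 y).const_mul p).div_const A).add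
      (((hasDerivAt_pow 4 y).const_mul (C / 4)).div_const (A ^ 3))).const_mul (A ^ (-p))) ?_
    push_cast
    field_simp
  · rw [sub_nonneg]
    refine mul_le_mul_of_nonneg_left (hC _ (by positivity) ?_) (by positivity)
    rw [div_le_iff₀ hA]
    linarith

theorem le_second_difference (hp : 0 ≤ p) (hF : ∀ s, 0 < s → HasDerivAt F (-s ^ (-p)) s)
    {A h : ℝ} (hA : 0 < A) (hh : |h| < A) :
    A ^ (-p) * (p * h ^ 2 / A) ≤ F (A + h) + F (A - h) - 2 * F A := by
  wlog h0 : 0 ≤ h generalizing h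
  · have := this (h := -h) (by rwa [abs_neg]) (by linarith)
    simp only [sub_neg_eq_add, even_two.neg_pow] at this
    rw [← sub_eq_add_neg] at this
    linarith
  rw [abs_of_nonneg h0] at hh
  have := nonneg_of_hasDerivAt_nonneg (b := h)
    (k := fun h => (F (A + h) + F (A - h) - 2 * F A) - A ^ (-p) * (p * h ^ 2 / A))
    (k' := fun h => A ^ (-p) * ((1 - h / A) ^ (-p) - (1 + h / A) ^ (-p)) -
      A ^ (-p) * (2 * p * (h / A)))
    (fun y hy hyA => ?_) (by simp; ring) (fun y hy hyA => ?_) h0 le_rfl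
  · linarith
  · refine HasDerivAt.sub (hasDerivAt_second_difference hF hy (by linarith)) ?_
    refine HasDerivAt.congr_deriv ((((hasDerivAt_pow 2 y).const_mul p).div_const A).const_mul
      (A ^ (-p))) ?_
    push_cast
    field_simp
  · rw [sub_nonneg]
    refine mul_le_mul_of_nonneg_left (le_one_sub_rpow_sub hp (by positivity) ?_) (by positivity)
    rw [div_lt_one hA]
    linarith

/-! ### Super- and subharmonicity of radial functions. -/

/-- Since `|x ± e_i|² = |x|² + 1 ± 2 x_i`, averaging is a sum of second differences of `F` about
`|x|² + 1 + b`. Their leading terms add up, through `∑ x_i² = |x|²`, to `A ^ (-d/2) * |x|² / A` with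
`A = |x|² + 1 + b`, which competes with the first difference `F (A - 1) - F A`. -/
theorem avg_radial (hd : d ≠ 0) (F : ℝ → ℝ) (b : ℝ) (x : Lattice d) :
    avg (fun y => F (enorm2 y ^ 2 + b)) x = F (enorm2 x ^ 2 + 1 + b) +
      1 / (2 * (d : ℝ)) * ∑ i, (F (enorm2 x ^ 2 + 1 + b + 2 * x i) +
        F (enorm2 x ^ 2 + 1 + b - 2 * x i) - 2 * F (enorm2 x ^ 2 + 1 + b)) := by
  have hd' : (d : ℝ) ≠ 0 := by exact_mod_cast hd
  unfold avg
  rw [Finset.sum_sub_distrib, mul_sub]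
  have : 1 / (2 * (d : ℝ)) * ∑ _i : Fin d, 2 * F (enorm2 x ^ 2 + 1 + b) =
      F (enorm2 x ^ 2 + 1 + b) := by
    simp
    field_simp
  rw [this, add_sub_cancel]
  congr 1
  refine Finset.sum_congr rfl fun i _ => ?_
  beta_reduce
  rw [enorm2_sq_add_single, enorm2_sq_sub_single]
  push_cast
  congr 2 <;> ring

/-- `F(|x|² + a)` is superharmonic for large `a`. -/
theorem exists_superharmonic (hd : d ≠ 0)
    (hF : ∀ s, 0 < s → HasDerivAt F (-s ^ (-((d : ℝ) / 2))) s) :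
    ∃ a : ℝ, 0 < a ∧ ∀ x : Lattice d,
      avg (fun y => F (enorm2 y ^ 2 + a)) x ≤ F (enorm2 x ^ 2 + a) := by
  have hd1 : (1 : ℝ) ≤ d := by exact_mod_cast Nat.one_le_iff_ne_zero.2 hd
  have hp : (0 : ℝ) ≤ (d : ℝ) / 2 := by positivity
  obtain ⟨C, hC0, hC⟩ := one_sub_rpow_sub_le hp
  -- The `3` gives `A ≥ |x|² + 4`, hence `|2 x_i| ≤ A / 2`; the `2 * C` absorbs the fourth-order
  -- error.
  refine ⟨2 * C + 3, by positivity, fun x => ?_⟩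
  rw [avg_radial hd]
  set t := enorm2 x ^ 2 with ht
  have ht0 : 0 ≤ t := sq_nonneg _
  obtain ⟨A, hA⟩ : ∃ A, A = t + 1 + (2 * C + 3) := ⟨_, rfl⟩
  have hA0 : 0 < A := by rw [hA]; positivity
  rw [← hA, show t + (2 * C + 3) = A - 1 by rw [hA]; ring]
  have hAt : t ≤ A := by rw [hA]; linarith
  have hPA : 0 < A ^ (-((d : ℝ) / 2)) := Real.rpow_pos_of_pos hA0 _
  have hdec : A ^ (-((d : ℝ) / 2)) ≤ F (A - 1) - F A := by
    have := (primitive_sub_bounds hp hF (s := A - 1) (t := A) (by rw [hA]; linarith)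
      (by linarith)).1
    simpa using this
  have hterm : ∀ i, F (A + 2 * x i) + F (A - 2 * x i) - 2 * F A ≤
      A ^ (-((d : ℝ) / 2)) * ((2 * d / A + 4 * C * t / A ^ 3) * (x i : ℝ) ^ 2) := by
    intro i
    have hxi : (x i : ℝ) ^ 2 ≤ t := by
      rw [ht, ← sq_abs]
      have := abs_coord_le_enorm2 x i
      gcongr
    have hxi' : |2 * (x i : ℝ)| ≤ A / 2 := by
      rw [abs_mul, abs_of_pos (two_pos : (0 : ℝ) < 2)]
      nlinarith [sq_nonneg (|(x i : ℝ)| - 2), sq_abs (x i : ℝ)]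
    refine (second_difference_le hF hC hA0 hxi').trans ?_
    refine mul_le_mul_of_nonneg_left ?_ hPA.le
    have : (x i : ℝ) ^ 4 ≤ t * (x i : ℝ) ^ 2 := by nlinarith [sq_nonneg (x i : ℝ)]
    calc (d : ℝ) / 2 * (2 * (x i : ℝ)) ^ 2 / A + C / 4 * (2 * (x i : ℝ)) ^ 4 / A ^ 3
        = 2 * d / A * (x i : ℝ) ^ 2 + 4 * C / A ^ 3 * (x i : ℝ) ^ 4 := by ring
      _ ≤ 2 * d / A * (x i : ℝ) ^ 2 + 4 * C / A ^ 3 * (t * (x i : ℝ) ^ 2) := by gcongr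
      _ = _ := by ring
  have hsum := Finset.sum_le_sum fun i (_ : i ∈ Finset.univ) => hterm i
  rw [← Finset.mul_sum, ← Finset.mul_sum, ← enorm2_sq, ← ht] at hsum
  have hfin : (2 * d / A + 4 * C * t / A ^ 3) * t ≤ 2 * d := by
    have h1 : (2 * d / A + 4 * C * t / A ^ 3) * t ≤ 2 * d / A * t + 4 * C / A := by
      have : t ^ 2 / A ^ 2 ≤ 1 := by
        rw [div_le_one (by positivity)]
        gcongr
      calc (2 * d / A + 4 * C * t / A ^ 3) * t
          = 2 * d / A * t + 4 * C / A * (t ^ 2 / A ^ 2) := by field_simp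
        _ ≤ 2 * d / A * t + 4 * C / A * 1 := by gcongr
        _ = _ := by ring
    refine h1.trans ?_
    rw [div_mul_eq_mul_div, ← add_div, div_le_iff₀ hA0, hA]
    nlinarith
  have h2 : 1 / (2 * (d : ℝ)) * ∑ i, (F (A + 2 * x i) + F (A - 2 * x i) - 2 * F A) ≤
      A ^ (-((d : ℝ) / 2)) := by
    rw [one_div, inv_mul_le_iff₀ (by positivity), mul_comm (2 * (d : ℝ))]
    exact hsum.trans (mul_le_mul_of_nonneg_left hfin hPA.le)
  linarith

/-- `F(|x|² - (d + 1))` is subharmonic far from the origin. -/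
theorem radial_subharmonic (hd : 2 ≤ d)
    (hF : ∀ s, 0 < s → HasDerivAt F (-s ^ (-((d : ℝ) / 2))) s) {x : Lattice d}
    (hx : (d : ℝ) + 3 ≤ enorm2 x) :
    F (enorm2 x ^ 2 + -((d : ℝ) + 1)) ≤ avg (fun y => F (enorm2 y ^ 2 + -((d : ℝ) + 1))) x := by
  have hd2 : (2 : ℝ) ≤ d := by exact_mod_cast hd
  have hp : (0 : ℝ) ≤ (d : ℝ) / 2 := by positivity
  rw [avg_radial (by omega)]
  set t := enorm2 x ^ 2 with ht
  have ht0 : ((d : ℝ) + 3) ^ 2 ≤ t := by rw [ht]; gcongr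
  obtain ⟨A, hA⟩ : ∃ A, A = t + 1 + -((d : ℝ) + 1) := ⟨_, rfl⟩
  have hA1 : (d : ℝ) + 1 < A := by rw [hA]; nlinarith
  have hA0 : 0 < A := by linarith
  rw [← hA, show t + -((d : ℝ) + 1) = A - 1 by rw [hA]; ring]
  have hPA : 0 < A ^ (-((d : ℝ) / 2)) := Real.rpow_pos_of_pos hA0 _
  have hdec : F (A - 1) - F A ≤ (A - 1) ^ (-((d : ℝ) / 2)) := by
    have := (primitive_sub_bounds hp hF (s := A - 1) (t := A) (by linarith) (by linarith)).2
    simpa using this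
  have hterm : ∀ i, A ^ (-((d : ℝ) / 2)) * (2 * d / A * (x i : ℝ) ^ 2) ≤
      F (A + 2 * x i) + F (A - 2 * x i) - 2 * F A := by
    intro i
    have hxi' : |2 * (x i : ℝ)| < A := by
      rw [abs_mul, abs_of_pos (two_pos : (0 : ℝ) < 2)]
      have := abs_coord_le_enorm2 x i
      rw [hA, ht]
      nlinarith
    refine le_trans (le_of_eq ?_) (le_second_difference hp hF hA0 hxi')
    ring
  have hsum := Finset.sum_le_sum fun i (_ : i ∈ Finset.univ) => hterm i
  rw [← Finset.mul_sum, ← Finset.mul_sum, ← enorm2_sq, ← ht] at hsum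
  -- Bernoulli, with exponent `d / 2 ≥ 1`, reduces this to `(1 - d / (2A)) (1 + d / A) ≥ 1`, which
  -- holds for `A ≥ d`; the shift `-(d + 1)` makes `|x|² = A + d`.
  have hpow : (A - 1) ^ (-((d : ℝ) / 2)) ≤ A ^ (-((d : ℝ) / 2)) * (t / A) := by
    have hb : 1 - (d : ℝ) / 2 / A ≤ ((A - 1) / A) ^ ((d : ℝ) / 2) := by
      have := one_add_mul_self_le_rpow_one_add (s := -1 / A) (p := (d : ℝ) / 2)
        (by rw [le_div_iff₀ hA0]; linarith) (by linarith)
      convert this using 1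
      · ring
      · congr 1
        field_simp
        ring
    rw [Real.rpow_neg (by linarith), Real.rpow_neg hA0.le]
    have hA1' : 0 < (A - 1) ^ ((d : ℝ) / 2) := Real.rpow_pos_of_pos (by linarith) _
    have hA0' : 0 < A ^ ((d : ℝ) / 2) := Real.rpow_pos_of_pos hA0 _
    rw [Real.div_rpow (by linarith) hA0.le, le_div_iff₀ hA0'] at hb
    rw [inv_le_iff_one_le_mul₀ hA1']
    have h1 : 1 ≤ (1 - (d : ℝ) / 2 / A) * (t / A) := by
      rw [show (1 - (d : ℝ) / 2 / A) * (t / A) = (A - (d : ℝ) / 2) * t / A ^ 2 by field_simp,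
        le_div_iff₀ (by positivity)]
      have : t = A + d := by rw [hA]; ring
      rw [this]
      nlinarith
    calc (1 : ℝ) ≤ (1 - (d : ℝ) / 2 / A) * (t / A) := h1
      _ = (A ^ ((d : ℝ) / 2))⁻¹ * (t / A) * ((1 - (d : ℝ) / 2 / A) * A ^ ((d : ℝ) / 2)) := by
        field_simp
      _ ≤ _ := by
        have : 0 ≤ t / A := div_nonneg (by positivity) hA0.le
        gcongr
  have h2 : A ^ (-((d : ℝ) / 2)) * (t / A) ≤
      1 / (2 * (d : ℝ)) * ∑ i, (F (A + 2 * x i) + F (A - 2 * x i) - 2 * F A) := by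
    rw [one_div, le_inv_mul_iff₀ (by positivity)]
    refine le_trans (le_of_eq ?_) hsum
    ring
  linarith

end Primitive

/-! ### Subharmonic comparison function. -/

/-- A compactly supported nonnegative function, subharmonic off the origin, and strictly
subharmonic off the origin on an `ℓ¹` ball. -/
theorem exists_subharmonic_bump (hd : d ≠ 0) (L : ℕ) : ∃ (η : Lattice d → ℝ) (δ : ℝ), 0 < δ ∧
    (∀ x, 0 ≤ η x) ∧ (∀ x, L ≤ norm1 x → η x = 0) ∧ (∀ x, x ≠ 0 → η x ≤ avg η x) ∧
    ∀ x, x ≠ 0 → norm1 x < L → η x + δ ≤ avg η x := by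
  have hd1 : (1 : ℝ) ≤ d := by exact_mod_cast Nat.one_le_iff_ne_zero.2 hd
  -- With this ratio, `1 / (2d) = 2 * l`: the one neighbour closer to the origin already contributes
  -- twice `l ^ norm1 x` to the average, up to the cutoff.
  obtain ⟨l, hl⟩ : ∃ l : ℝ, l = 1 / (4 * d) := ⟨_, rfl⟩
  have hl0 : 0 < l := by rw [hl]; positivity
  have hl1 : l ≤ 1 := by
    rw [hl, div_le_one (by positivity)]
    linarith
  have hnn : ∀ x : Lattice d, 0 ≤ max (l ^ norm1 x - l ^ L) 0 := fun x => le_max_right _ _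
  have hzero : ∀ x : Lattice d, L ≤ norm1 x → max (l ^ norm1 x - l ^ L) 0 = 0 := by
    intro x hx
    refine max_eq_right (sub_nonpos.2 ?_)
    exact pow_le_pow_of_le_one hl0.le hl1 hx
  have hstrict : ∀ x : Lattice d, x ≠ 0 → norm1 x < L →
      max (l ^ norm1 x - l ^ L) 0 + l ^ L ≤ avg (fun x => max (l ^ norm1 x - l ^ L) 0) x := by
    intro x hx hxL
    obtain ⟨y, hy, hyx⟩ := exists_neighbour_norm1 hx
    refine le_trans ?_ (le_avg_of_neighbour hnn hy)
    have hLx : l ^ L ≤ l ^ norm1 x := pow_le_pow_of_le_one hl0.le hl1 hxL.le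
    have hLy : l ^ L ≤ l ^ norm1 y := pow_le_pow_of_le_one hl0.le hl1 (by omega)
    rw [max_eq_left (sub_nonneg.2 hLx), max_eq_left (sub_nonneg.2 hLy), ← hyx, pow_succ]
    have e1 : 1 / (2 * (d : ℝ)) = 2 * l := by rw [hl]; field_simp; norm_num
    have hl4 : l ≤ 1 / 4 := by
      rw [hl, div_le_div_iff₀ (by positivity) (by norm_num)]
      linarith
    rw [← hyx, pow_succ] at hLx
    rw [e1]
    have := pow_pos hl0 L
    nlinarith
  refine ⟨fun x => max (l ^ norm1 x - l ^ L) 0, l ^ L, by positivity, hnn, hzero, ?_, hstrict⟩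
  intro x hx
  rcases lt_or_ge (norm1 x) L with h | h
  · exact le_trans (le_add_of_nonneg_right (by positivity)) (hstrict x hx h)
  · simp only [hzero x h]
    exact avg_nonneg hnn x

/-- A function with the profile of the Green function which is subharmonic off the origin. -/
theorem exists_subharmonic (hd : 2 ≤ d) {F : ℝ → ℝ}
    (hF : ∀ s, 0 < s → HasDerivAt F (-s ^ (-((d : ℝ) / 2))) s) :
    ∃ (ψ : Lattice d → ℝ) (ε ρ : ℝ), 0 < ε ∧ (∀ x, x ≠ 0 → ψ x ≤ avg ψ x) ∧
      ε * (ψ 0 - avg ψ 0) ≤ 1 ∧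
      ∀ x, ρ ≤ enorm2 x → ψ x = F (enorm2 x ^ 2 - ((d : ℝ) + 1)) := by
  have hd0 : d ≠ 0 := by omega
  have hp : (0 : ℝ) ≤ (d : ℝ) / 2 := by positivity
  obtain ⟨ρ, hρ⟩ : ∃ ρ : ℝ, ρ = (d : ℝ) + 3 := ⟨_, rfl⟩
  have hρ0 : 0 < ρ := by rw [hρ]; positivity
  obtain ⟨L, hL⟩ := exists_nat_gt (d * ρ)
  obtain ⟨η, δ, hδ, hη0, hηL, hηs, hηss⟩ := exists_subharmonic_bump (d := d) hd0 L
  -- The truncation at `1` keeps the argument of `F` positive. It spoils subharmonicity only within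
  -- radius `ρ`, by at most `B`, and `B / δ` times the bump repairs that.
  obtain ⟨Ψ, hΨ⟩ : ∃ Ψ : Lattice d → ℝ,
      Ψ = fun x => F (max (enorm2 x ^ 2 + -((d : ℝ) + 1)) 1) := ⟨_, rfl⟩
  have hfar : ∀ x : Lattice d, ρ - 1 ≤ enorm2 x →
      Ψ x = F (enorm2 x ^ 2 + -((d : ℝ) + 1)) := by
    intro x hx
    rw [hΨ]
    simp only
    rw [max_eq_left]
    rw [hρ] at hx
    have : (0 : ℝ) ≤ d := by positivity
    nlinarith
  obtain ⟨B, hB⟩ : ∃ B, B = F 1 - F ((ρ + 1) ^ 2) := ⟨_, rfl⟩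
  have hB0 : 0 ≤ B := by
    rw [hB, sub_nonneg]
    exact primitive_antitone hp hF one_pos (by nlinarith)
  have hsub : ∀ x : Lattice d, x ≠ 0 → Ψ x + B / δ * η x ≤
      avg (fun x => Ψ x + B / δ * η x) x := by
    intro x hx
    rw [avg_add, avg_const_mul]
    rcases le_or_gt ρ (enorm2 x) with h | h
    · have h1 : Ψ x ≤ avg Ψ x := by
        rw [hfar x (by linarith)]
        refine (radial_subharmonic hd hF (by linarith)).trans (avg_mono fun y hy => ?_)
        rw [hfar y]
        linarith [enorm2_neighbour_le (neighbour_symm hy)]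
      have h2 : B / δ * η x ≤ B / δ * avg η x := by
        have := hηs x hx
        gcongr
      linarith
    · have h1 : Ψ x ≤ F 1 := by
        rw [hΨ]
        exact primitive_antitone hp hF one_pos (le_max_right _ _)
      have h2 : F ((ρ + 1) ^ 2) ≤ avg Ψ x := by
        refine le_avg hd0 fun y hy => ?_
        rw [hΨ]
        refine primitive_antitone hp hF (by positivity) (max_le ?_ (by nlinarith))
        have h3 : enorm2 y ≤ ρ + 1 := (enorm2_neighbour_le hy).trans (by linarith)
        have h4 : enorm2 y ^ 2 ≤ (ρ + 1) ^ 2 := by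
          have := enorm2_nonneg y
          gcongr
        have : (0 : ℝ) ≤ d := by positivity
        linarith
      have h3 : B / δ * (η x + δ) ≤ B / δ * avg η x := by
        have hxL : norm1 x < L := by
          have : (norm1 x : ℝ) < L := by
            refine (norm1_le_mul_enorm2 x).trans_lt (lt_of_le_of_lt ?_ hL)
            gcongr
          exact_mod_cast this
        have := hηss x hx hxL
        gcongr
      rw [mul_add, div_mul_cancel₀ B hδ.ne'] at h3
      linarith
  obtain ⟨ψ, hψ⟩ : ∃ ψ : Lattice d → ℝ, ψ = fun x => Ψ x + B / δ * η x := ⟨_, rfl⟩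
  rw [← hψ] at hsub
  refine ⟨ψ, 1 / (1 + |ψ 0 - avg ψ 0|), max ρ L, by positivity, ?_, ?_, ?_⟩
  · intro x hx
    have := hsub x hx
    rw [hψ] at this ⊢
    exact this
  · rw [div_mul_eq_mul_div, one_mul, div_le_one (by positivity)]
    linarith [le_abs_self (ψ 0 - avg ψ 0)]
  · intro x hx
    have h1 : L ≤ norm1 x := by
      have : (L : ℝ) ≤ norm1 x := ((le_max_right _ _).trans hx).trans (enorm2_le_norm1 x)
      exact_mod_cast this
    rw [hψ]
    simp only
    rw [hηL x h1, mul_zero, add_zero, hfar x (by linarith [(le_max_left _ _).trans hx]),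
      sub_eq_add_neg]

/-! ### The supersolution for the outer bound. -/

theorem enorm2_le_of_mem_discBall {R : ℝ} {x : Lattice d} (hx : x ∈ discBall d R) :
    enorm2 x ≤ R + 1 := by
  rcases hx with h | ⟨ξ, hξ, hξR, -⟩
  · exact le_trans h (by linarith)
  · exact (enorm2_neighbour_le (neighbour_symm hξ)).trans (by linarith)

theorem rpow_sq_half {r : ℝ} (hr : 0 ≤ r) (d : ℕ) : (r ^ 2) ^ (-((d : ℝ) / 2)) = (r ^ d)⁻¹ := by
  rw [Real.rpow_neg (sq_nonneg r), ← Real.rpow_natCast r 2, ← Real.rpow_mul hr,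
    ← Real.rpow_natCast r d]
  congr 2
  push_cast
  ring

/-- A supersolution for `BS(κ^d δ₀, κ)` on a ball of radius of order `κ`. -/
theorem exists_supersolution (hd : 2 ≤ d) : ∃ C : ℝ, 1 ≤ C ∧ ∀ κ : ℝ, 1 ≤ κ →
    ∃ w : Lattice d → ℝ, (∀ x, 0 ≤ w x) ∧
      (∀ x, enorm2 x ≤ C * κ → pointMass d (κ ^ d) x + avg w x ≤ w x) ∧
      ∀ x, C * κ < enorm2 x → w x = 0 ∧ avg w x ≤ κ := by
  have hd0 : d ≠ 0 := by omega
  have hp : (0 : ℝ) ≤ (d : ℝ) / 2 := by positivity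
  obtain ⟨F, hF⟩ := exists_primitive_rpow ((d : ℝ) / 2)
  obtain ⟨a, ha, hsup⟩ := exists_superharmonic hd0 hF
  have hgap : 0 < F a - F (1 + a) := by
    have h1 := (primitive_sub_bounds hp hF ha (by linarith : a ≤ 1 + a)).1
    have h2 : 0 < (1 + a) ^ (-((d : ℝ) / 2)) := Real.rpow_pos_of_pos (by linarith) _
    rw [add_sub_cancel_right, one_mul] at h1
    linarith
  -- Normalises the drop at the origin, where all neighbours have `|y|² = 1`, to match the source `κ
  -- ^ d`.
  obtain ⟨K, hK⟩ : ∃ K, K = 1 / (F a - F (1 + a)) := ⟨_, rfl⟩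
  have hK0 : 0 < K := by rw [hK]; positivity
  obtain ⟨C, hC⟩ : ∃ C, C = max 2 (K * 4 * 2 ^ d) := ⟨_, rfl⟩
  have hC2 : 2 ≤ C := hC ▸ le_max_left _ _
  have hCK : K * 4 * 2 ^ d ≤ C := hC ▸ le_max_right _ _
  refine ⟨C, by linarith, fun κ hκ => ?_⟩
  obtain ⟨R, hR⟩ : ∃ R, R = C * κ := ⟨_, rfl⟩
  have hR2 : 2 ≤ R := by rw [hR]; nlinarith
  rw [← hR]
  have hκd : 0 < κ ^ d := by positivity
  -- Subtracting the value at radius `R + 1`, not `R`, keeps the uncut profile nonnegative at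
  -- outside neighbours of the ball, so the cutoff only lowers averages.
  obtain ⟨m, hm⟩ : ∃ m, m = F ((R + 1) ^ 2 + a) := ⟨_, rfl⟩
  have hmono : ∀ x : Lattice d, enorm2 x ≤ R + 1 → m ≤ F (enorm2 x ^ 2 + a) := by
    intro x hx
    rw [hm]
    have := enorm2_nonneg x
    exact primitive_antitone hp hF (by positivity) (by gcongr)
  obtain ⟨w, hw⟩ : ∃ w : Lattice d → ℝ, w = fun x =>
    if enorm2 x ≤ R then K * κ ^ d * (F (enorm2 x ^ 2 + a) - m) else 0 := ⟨_, rfl⟩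
  have hw_in : ∀ x, enorm2 x ≤ R → w x = K * κ ^ d * (F (enorm2 x ^ 2 + a) - m) :=
    fun x hx => by rw [hw]; exact if_pos hx
  have hw_out : ∀ x, R < enorm2 x → w x = 0 := fun x hx => by rw [hw]; exact if_neg (not_le.2 hx)
  have hKκ : 0 < K * κ ^ d := by positivity
  refine ⟨w, fun x => ?_, fun x hx => ?_, fun x hx => ⟨hw_out x hx, ?_⟩⟩
  · rcases le_or_gt (enorm2 x) R with h | h
    · rw [hw_in x h]
      exact mul_nonneg hKκ.le (sub_nonneg.2 (hmono x (by linarith)))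
    · rw [hw_out x h]
  · have h1 : avg w x ≤ K * κ ^ d * (avg (fun y => F (enorm2 y ^ 2 + a)) x - m) := by
      rw [← avg_sub_const hd0, ← avg_const_mul]
      refine avg_mono fun y hy => ?_
      rcases le_or_gt (enorm2 y) R with h | h
      · rw [hw_in y h]
      · rw [hw_out y h]
        exact mul_nonneg hKκ.le
          (sub_nonneg.2 (hmono y ((enorm2_neighbour_le hy).trans (by linarith))))
    rw [hw_in x hx]
    by_cases hx0 : x = 0
    · subst hx0
      have h2 : avg (fun y : Lattice d => F (enorm2 y ^ 2 + a)) 0 = F (1 + a) := by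
        rw [avg_radial hd0]
        simp [enorm2_zero]
        right
        ring
      have h3 : K * κ ^ d * (F a - F (1 + a)) = κ ^ d := by
        rw [hK]
        field_simp
      rw [h2] at h1
      simp only [pointMass, Pi.single_eq_same, enorm2_zero, ne_eq, OfNat.ofNat_ne_zero,
        not_false_eq_true, zero_pow, zero_add]
      linarith
    · have h2 := mul_le_mul_of_nonneg_left (sub_le_sub_right (hsup x) m) hKκ.le
      simp only [pointMass, Pi.single_eq_of_ne hx0, zero_add]
      exact h1.trans h2
  · refine avg_le hd0 fun y hy => ?_
    rcases le_or_gt (enorm2 y) R with h | h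
    · rw [hw_in y h]
      have hy1 : R - 1 ≤ enorm2 y := by
        linarith [enorm2_neighbour_le (neighbour_symm hy)]
      have h1 : F (enorm2 y ^ 2 + a) ≤ F ((R - 1) ^ 2 + a) := by
        refine primitive_antitone hp hF (by positivity) ?_
        have : 0 ≤ R - 1 := by linarith
        gcongr
      have h2 : F ((R - 1) ^ 2 + a) - m ≤ 4 * R * ((R / 2) ^ d)⁻¹ := by
        rw [hm, ← rpow_sq_half (by linarith)]
        refine (primitive_sub_bounds hp hF (by positivity)
          (by nlinarith : (R - 1) ^ 2 + a ≤ (R + 1) ^ 2 + a)).2.trans ?_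
        rw [show (R + 1) ^ 2 + a - ((R - 1) ^ 2 + a) = 4 * R by ring]
        refine mul_le_mul_of_nonneg_left ?_ (by linarith)
        exact Real.rpow_le_rpow_of_nonpos (by positivity) (by nlinarith) (by linarith)
      calc K * κ ^ d * (F (enorm2 y ^ 2 + a) - m)
          ≤ K * κ ^ d * (4 * R * ((R / 2) ^ d)⁻¹) := by
            refine mul_le_mul_of_nonneg_left ?_ hKκ.le
            linarith
        _ = κ * (K * 4 * 2 ^ d * C / C ^ d) := by
            have : κ ≠ 0 := by positivity
            have : C ≠ 0 := by positivity
            rw [hR, div_pow, mul_pow]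
            field_simp
        _ ≤ κ * 1 := by
            refine mul_le_mul_of_nonneg_left ?_ (by linarith)
            rw [div_le_one (by positivity)]
            calc K * 4 * 2 ^ d * C ≤ C * C := by gcongr
              _ = C ^ 2 := by ring
              _ ≤ C ^ d := pow_le_pow_right₀ (by linarith) hd
        _ = κ := mul_one κ
    · rw [hw_out y h]
      linarith

/-! ### Minimum principle and Harnack-type growth. -/

/-- Minimum principle on a finite set. -/
theorem nonneg_of_avg_le (hd : d ≠ 0) {U : Set (Lattice d)} (hU : U.Finite) {D : Lattice d → ℝ}
    (hin : ∀ x ∈ U, avg D x ≤ D x) (hout : ∀ x ∉ U, 0 ≤ D x) (x : Lattice d) : 0 ≤ D x := by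
  by_contra! hx
  have hxU : x ∈ U := by
    by_contra hc
    exact absurd (hout x hc) (not_le.2 hx)
  obtain ⟨x₀, hx₀U, hx₀⟩ := Set.exists_min_image U D hU ⟨x, hxU⟩
  have hneg : D x₀ < 0 := (hx₀ x hxU).trans_lt hx
  have hmin : ∀ y, D x₀ ≤ D y := fun y => by
    by_cases hy : y ∈ U
    · exact hx₀ y hy
    · exact hneg.le.trans (hout y hy)
  obtain ⟨i⟩ : Nonempty (Fin d) := ⟨⟨0, Nat.pos_of_ne_zero hd⟩⟩
  -- Among minimisers take one with largest `i`-th coordinate: its neighbour in direction `i` must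
  -- be a minimiser too.
  obtain ⟨z, ⟨hzU, hz⟩, hzmax⟩ := Set.exists_max_image {y | y ∈ U ∧ D y = D x₀} (fun y => y i)
    (hU.subset fun y hy => hy.1) ⟨x₀, hx₀U, rfl⟩
  have hnb : D (z + Pi.single i 1) = D x₀ := by
    refine le_antisymm ?_ (hmin _)
    have h1 := le_avg_of_neighbour (f := fun y => D y - D x₀) (fun y => sub_nonneg.2 (hmin y))
      (neighbour_add_single z i)
    rw [avg_sub_const hd] at h1
    have h2 := hin z hzU
    rw [hz] at h2
    have h3 : 1 / (2 * (d : ℝ)) * (D (z + Pi.single i 1) - D x₀) ≤ 0 := h1.trans (by linarith)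
    have h4 : 0 < 1 / (2 * (d : ℝ)) := by
      have : 0 < (d : ℝ) := by exact_mod_cast Nat.pos_of_ne_zero hd
      positivity
    nlinarith
  have hnbU : z + Pi.single i 1 ∈ U := by
    by_contra hc
    have := hout _ hc
    linarith
  have := hzmax _ ⟨hnbU, hnb⟩
  simp at this

namespace FinalState

variable {V : Set (Lattice d)} {u : Lattice d → ℝ} {n κ : ℝ}

theorem le_mul_of_neighbour (hd : d ≠ 0) {μ₀ : Lattice d → ℝ} (h : FinalState μ₀ κ V u)
    (hμ : ∀ x, 0 ≤ μ₀ x) {x y : Lattice d} (hx : x ∈ V) (hxy : Neighbour y x) :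
    u y ≤ 2 * d * max κ (u x) := by
  have h1 := le_avg_of_neighbour h.nonneg hxy
  have h2 := h.le_of_mem x hx
  have h3 := hμ x
  have hd' : 0 < (d : ℝ) := by exact_mod_cast Nat.pos_of_ne_zero hd
  have h4 : 1 / (2 * (d : ℝ)) * u y ≤ max κ (u x) := by linarith
  rwa [one_div, inv_mul_le_iff₀ (by positivity)] at h4

theorem pointMass_nonneg (hn : 0 ≤ n) (x : Lattice d) : 0 ≤ pointMass d n x := by
  unfold pointMass
  by_cases hx : x = 0
  · subst hx; simpa
  · simp [hx]

/-- Harnack chain from the origin. -/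
theorem le_of_norm1_le (hd : d ≠ 0) (hn : 0 < n) (h : FinalState (pointMass d n) κ V u)
    (h0 : 0 ∈ V) (M : ℕ) (hM : (2 * d) ^ M * κ < n) {x : Lattice d} (hx : norm1 x ≤ M) :
    n ≤ (2 * d) ^ norm1 x * u x := by
  have hd1 : (1 : ℝ) ≤ d := by exact_mod_cast Nat.one_le_iff_ne_zero.2 hd
  obtain ⟨k, hk⟩ : ∃ k, k = norm1 x := ⟨_, rfl⟩
  rw [← hk] at hx ⊢
  have hκ : ∀ k ≤ M, (2 * (d : ℝ)) ^ k * κ < n := by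
    intro k hk
    rcases le_or_gt κ 0 with hκ | hκ
    · exact (mul_nonpos_of_nonneg_of_nonpos (by positivity) hκ).trans_lt hn
    · refine lt_of_le_of_lt ?_ hM
      have : (2 * (d : ℝ)) ^ k ≤ (2 * d) ^ M := pow_le_pow_right₀ (by linarith) hk
      gcongr
  -- As `(2d) ^ k * κ < n`, the maximum cannot be attained by `κ` alone.
  have hmax : ∀ k ≤ M, ∀ x, n ≤ (2 * (d : ℝ)) ^ k * max κ (u x) →
      n ≤ (2 * (d : ℝ)) ^ k * u x := by
    intro k hk x hx
    rcases le_total κ (u x) with h | h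
    · rwa [max_eq_right h] at hx
    · rw [max_eq_left h] at hx
      linarith [hκ k hk]
  induction k generalizing x with
  | zero =>
    have hx0 : x = 0 := norm1_eq_zero.1 hk.symm
    subst hx0
    refine hmax 0 hx 0 ?_
    have h1 := h.le_of_mem 0 h0
    have h2 := avg_nonneg h.nonneg (0 : Lattice d)
    simp only [pointMass, Pi.single_eq_same] at h1
    simp only [pow_zero, one_mul]
    linarith
  | succ k ih =>
    have hx0 : x ≠ 0 := by
      rintro rfl
      rw [norm1_eq_zero.2 rfl] at hk
      omega
    obtain ⟨y, hy, hyx⟩ := exists_neighbour_norm1 hx0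
    have h1 := ih (x := y) (by omega) (by omega)
    have hy0 : 0 < u y := by
      by_contra! hc
      have : (2 * (d : ℝ)) ^ k * u y ≤ 0 := mul_nonpos_of_nonneg_of_nonpos (by positivity) hc
      linarith
    have hxV : x ∈ V := (h.mem_of_pos y hy0).2 x (neighbour_symm hy)
    refine hmax (k + 1) hx x (h1.trans ?_)
    have h2 := h.le_mul_of_neighbour hd (pointMass_nonneg hn.le) hxV hy
    rw [pow_succ, mul_assoc]
    gcongr

/-- The odometer grows at most geometrically along a path issued from an unvisited site. -/
theorem le_pow_mul_of_path (hd : d ≠ 0) {μ₀ : Lattice d → ℝ} (h : FinalState μ₀ κ V u)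
    (hμ : ∀ x, 0 ≤ μ₀ x) (hκ : 0 ≤ κ) {γ : ℕ → Lattice d} (h0 : γ 0 ∉ V)
    (hγ : ∀ j, Neighbour (γ (j + 1)) (γ j)) (m : ℕ) (hV : ∀ j, 1 ≤ j → j < m → γ j ∈ V) :
    u (γ m) ≤ (2 * d) ^ m * κ := by
  have hd1 : (1 : ℝ) ≤ d := by exact_mod_cast Nat.one_le_iff_ne_zero.2 hd
  induction m with
  | zero =>
    have : u (γ 0) ≤ 0 := not_lt.1 fun hc => h0 (h.mem_of_pos _ hc).1
    simp
    linarith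
  | succ m ih =>
    have h1 := ih fun j hj hjm => hV j hj (by omega)
    -- The starting site is unvisited, so `le_mul_of_neighbour` does not apply there; but a
    -- neighbour of an unvisited site has not toppled.
    rcases Nat.eq_zero_or_pos m with rfl | hm
    · have h2 : u (γ 1) ≤ 0 :=
        not_lt.1 fun hc => h0 ((h.mem_of_pos _ hc).2 _ (neighbour_symm (hγ 0)))
      exact h2.trans (by positivity)
    · refine (h.le_mul_of_neighbour hd hμ (hV m hm (by omega)) (hγ m)).trans ?_
      rw [pow_succ, mul_comm _ (2 * (d : ℝ)), mul_assoc (2 * (d : ℝ))]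
      have : κ ≤ (2 * (d : ℝ)) ^ m * κ :=
        le_mul_of_one_le_left hκ (one_le_pow₀ (by linarith))
      exact mul_le_mul_of_nonneg_left (max_le this h1) (by positivity)

end FinalState

/-- From a far site one can walk straight towards the origin, getting closer by `2`. -/
theorem exists_inward_path (hd : d ≠ 0) {z : Lattice d} (hz : 4 * (d : ℝ) ^ 2 ≤ enorm2 z) :
    ∃ γ : ℕ → Lattice d, γ 0 = z ∧ (∀ j, Neighbour (γ (j + 1)) (γ j)) ∧
      (∀ j, 1 ≤ j → j ≤ 4 * d → enorm2 (γ j) < enorm2 z) ∧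
      enorm2 (γ (4 * d)) ≤ enorm2 z - 2 ∧ enorm2 z - 4 * d ≤ enorm2 (γ (4 * d)) := by
  have hd1 : (1 : ℝ) ≤ d := by exact_mod_cast Nat.one_le_iff_ne_zero.2 hd
  obtain ⟨i, hi⟩ := exists_max_coord hd z
  have hzi := enorm2_le_mul_max_coord hi
  have hzi' := abs_coord_le_enorm2 z i
  obtain ⟨s, hs, hsz⟩ : ∃ s : ℤ, (s = 1 ∨ s = -1) ∧ (s : ℝ) * z i = -|(z i : ℝ)| := by
    rcases le_total 0 (z i) with h | h
    · refine ⟨-1, Or.inr rfl, ?_⟩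
      rw [abs_of_nonneg (by exact_mod_cast h)]
      simp
    · refine ⟨1, Or.inl rfl, ?_⟩
      rw [abs_of_nonpos (by exact_mod_cast h)]
      simp
  have hss : (s : ℝ) ^ 2 = 1 := by rcases hs with rfl | rfl <;> norm_num
  have hnorm : ∀ j : ℕ, enorm2 (z + Pi.single i (j * s)) ^ 2 =
      enorm2 z ^ 2 - 2 * j * |(z i : ℝ)| + j ^ 2 := by
    intro j
    rw [enorm2_sq_add_single]
    push_cast
    rw [mul_pow, hss]
    linear_combination 2 * (j : ℝ) * hsz
  have hnn := enorm2_nonneg z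
  have hnnj : ∀ j : ℕ, 0 ≤ enorm2 (z + Pi.single i (j * s)) := fun j => enorm2_nonneg _
  refine ⟨fun j => z + Pi.single i (j * s), by simp, fun j => ?_, fun j hj hjd => ?_, ?_, ?_⟩
  · have : z + Pi.single i (((j + 1 : ℕ) : ℤ) * s) = z + Pi.single i ((j : ℤ) * s) +
        Pi.single i s := by
      rw [add_assoc, ← Pi.single_add]
      congr 2
      push_cast
      ring
    simp only [this]
    rcases hs with rfl | rfl
    · exact neighbour_add_single _ i
    · rw [Pi.single_neg, ← sub_eq_add_neg]
      exact neighbour_sub_single _ i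
  · refine lt_of_pow_lt_pow_left₀ 2 hnn ?_
    beta_reduce
    rw [hnorm]
    have hj1 : (1 : ℝ) ≤ j := by exact_mod_cast hj
    have hj2 : (j : ℝ) ≤ 4 * d := by exact_mod_cast hjd
    have : 4 * (d : ℝ) ≤ |(z i : ℝ)| := by nlinarith
    nlinarith
  -- Since `|z i| ≥ |z| / d`, `4 * d` steps lower `|z|²` by at least `8 |z| - 16 d²`, enough for a
  -- gain of `2`.
  · refine le_of_pow_le_pow_left₀ two_ne_zero (by nlinarith) ?_
    beta_reduce
    rw [hnorm]
    push_cast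
    nlinarith
  · refine le_of_pow_le_pow_left₀ two_ne_zero (hnnj _) ?_
    rw [hnorm]
    push_cast
    nlinarith

/-! ### The inner bound. -/

/-- Cancelling gives `ε * κ ^ (d - 1) ≤ Q * r ^ (d - 1)`. The minimum with `1` avoids a root, as a
number in `(0, 1]` dominates its powers. -/
theorem min_mul_le_of_flux_le (hd : 2 ≤ d) {ε Q κ r : ℝ} (hε : 0 < ε) (hQ : 0 < Q) (hκ : 0 < κ)
    (hr : 0 < r) (h : ε * κ ^ d * (r * (r ^ d)⁻¹) ≤ Q * κ) : min 1 (ε / Q) * κ ≤ r := by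
  obtain ⟨e, rfl⟩ : ∃ e, d = e + 1 := ⟨d - 1, by omega⟩
  have he : e ≠ 0 := by omega
  have h1 : ε * κ ^ e ≤ Q * r ^ e := by
    rw [pow_succ, pow_succ, show ε * (κ ^ e * κ) * (r * (r ^ e * r)⁻¹) =
      (ε * κ ^ e / r ^ e) * κ by field_simp] at h
    have := le_of_mul_le_mul_right h hκ
    rwa [div_le_iff₀ (by positivity)] at this
  have hc0 : 0 < min 1 (ε / Q) := lt_min one_pos (by positivity)
  refine le_of_pow_le_pow_left₀ he hr.le ?_
  calc (min 1 (ε / Q) * κ) ^ e = min 1 (ε / Q) ^ e * κ ^ e := mul_pow _ _ _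
    _ ≤ ε / Q * κ ^ e := by
      have := (pow_le_of_le_one hc0.le (min_le_left 1 (ε / Q)) he).trans (min_le_right 1 (ε / Q))
      gcongr
    _ ≤ r ^ e := by
      rw [div_mul_eq_mul_div, div_le_iff₀ hQ]
      linarith

/-- The inner radius is at least of order `κ`. -/
theorem exists_inner_radius (hd : 2 ≤ d) : ∃ c : ℝ, 0 < c ∧ ∃ M : ℕ, ∀ κ : ℝ, 1 ≤ κ →
    (2 * (d : ℝ)) ^ M * κ < κ ^ d → ∀ (V : Set (Lattice d)) (u : Lattice d → ℝ),
      FinalState (pointMass d (κ ^ d)) κ V u → 0 ∈ V →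
      ∀ z ∉ V, 4 ≤ enorm2 z ∧ c * κ ≤ enorm2 z := by
  have hd0 : d ≠ 0 := by omega
  have hd2 : (2 : ℝ) ≤ d := by exact_mod_cast hd
  have hp : (0 : ℝ) ≤ (d : ℝ) / 2 := by positivity
  obtain ⟨F, hF⟩ := exists_primitive_rpow ((d : ℝ) / 2)
  obtain ⟨ψ, ε, ρ, hε, hψs, hψ0, hψρ⟩ := exists_subharmonic hd hF
  -- Large enough that a point `4 * d` steps inside still lies where `ψ` is radial, and that
  -- `exists_inward_path` applies; the Harnack chain of length `M` shows that this ball is visited.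
  obtain ⟨r₀, hr₀⟩ : ∃ r₀ : ℝ, r₀ = |ρ| + 4 * d ^ 2 + 4 * d + 4 := ⟨_, rfl⟩
  have hr₀0 : 0 < r₀ := by rw [hr₀]; positivity
  obtain ⟨M, hM⟩ := exists_nat_gt (d * r₀)
  obtain ⟨c, hc⟩ : ∃ c, c = min 1 (ε / (2 * d) ^ (4 * d)) := ⟨_, rfl⟩
  have hc0 : 0 < c := by
    rw [hc]
    exact lt_min one_pos (by positivity)
  refine ⟨c, hc0, M, fun κ hκ hMκ V u h h0 => ?_⟩
  have hκd : 0 < κ ^ d := by positivity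
  have hfar : ∀ z ∉ V, r₀ ≤ enorm2 z := by
    intro z hz
    by_contra! hlt
    have hzM : norm1 z ≤ M := by
      have h1 : (norm1 z : ℝ) ≤ M := by
        refine (norm1_le_mul_enorm2 z).trans (le_trans ?_ hM.le)
        gcongr
      exact_mod_cast h1
    have h1 := h.le_of_norm1_le hd0 hκd h0 M hMκ hzM
    refine hz (h.mem_of_pos z ?_).1
    by_contra! hc
    have : (2 * (d : ℝ)) ^ norm1 z * u z ≤ 0 :=
      mul_nonpos_of_nonneg_of_nonpos (by positivity) hc
    linarith
  suffices hmain : ∀ z ∉ V, (∀ y, enorm2 y < enorm2 z → y ∈ V) → c * κ ≤ enorm2 z by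
    intro z hz
    refine ⟨le_trans (by rw [hr₀]; nlinarith [abs_nonneg ρ]) (hfar z hz), ?_⟩
    obtain ⟨z₀, ⟨hz₀V, hz₀z⟩, hmin⟩ := Set.exists_min_image
      {y | y ∉ V ∧ enorm2 y ≤ enorm2 z} enorm2
      ((finite_enorm2_le (enorm2 z)).subset fun y hy => hy.2) ⟨z, hz, le_rfl⟩
    refine (hmain z₀ hz₀V fun y hy => ?_).trans hz₀z
    by_contra hyV
    exact absurd (hmin y ⟨hyV, hy.le.trans hz₀z⟩) (not_le.2 hy)
  intro z hz hball
  have hr := hfar z hz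
  obtain ⟨r, hrz⟩ : ∃ r, r = enorm2 z := ⟨_, rfl⟩
  rw [← hrz] at hr hball ⊢
  have hρr : |ρ| + 4 * d ^ 2 + 4 * d + 4 ≤ r := hr₀ ▸ hr
  have hρ := le_abs_self ρ
  have hρ' := abs_nonneg ρ
  have hr1 : (d : ℝ) + 4 ≤ r := by nlinarith
  -- The comparison runs on `|x| < r - 1`, where all neighbours are visited; `m` is the profile at
  -- that radius, so `ψ ≤ m` beyond it.
  obtain ⟨m, hm⟩ : ∃ m, m = F ((r - 1) ^ 2 - (d + 1)) := ⟨_, rfl⟩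
  have hcomp : ∀ x, 0 ≤ u x - ε * κ ^ d * (ψ x - m) := by
    have hU : {x : Lattice d | enorm2 x < r - 1}.Finite :=
      (finite_enorm2_le (r - 1)).subset fun x (hx : enorm2 x < r - 1) => hx.le
    refine nonneg_of_avg_le hd0 hU (fun x hx => ?_) (fun x hx => ?_)
    · have hx' : enorm2 x < r - 1 := hx
      have h1 := h.le_of_interior x (hball x (by linarith)) fun y hy =>
        hball y ((enorm2_neighbour_le hy).trans_lt (by linarith))
      have h2 : avg (fun x => u x - ε * κ ^ d * (ψ x - m)) x =
          avg u x - ε * κ ^ d * (avg ψ x - m) := by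
        have := avg_add u (fun x => -(ε * κ ^ d) * (ψ x - m)) x
        rw [avg_const_mul, avg_sub_const hd0] at this
        simp only [neg_mul, ← sub_eq_add_neg] at this
        exact this
      rw [h2]
      by_cases hx0 : x = 0
      · subst hx0
        simp only [pointMass, Pi.single_eq_same] at h1
        have h3 := mul_le_mul_of_nonneg_right hψ0 hκd.le
        nlinarith
      · simp only [pointMass, Pi.single_eq_of_ne hx0, zero_add] at h1
        have h3 := mul_le_mul_of_nonneg_left (hψs x hx0) (by positivity : 0 ≤ ε * κ ^ d)
        nlinarith
    · have hx' : r - 1 ≤ enorm2 x := not_lt.1 hx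
      have h1 : ψ x ≤ m := by
        rw [hψρ x (by nlinarith), hm]
        refine primitive_antitone hp hF (by nlinarith) ?_
        have : 0 ≤ r - 1 := by linarith
        gcongr
      have h2 : ε * κ ^ d * (ψ x - m) ≤ 0 :=
        mul_nonpos_of_nonneg_of_nonpos (by positivity) (by linarith)
      linarith [h.nonneg x]
  obtain ⟨γ, hγ0, hγ, hγlt, hγle, hγge⟩ := exists_inward_path hd0 (z := z) (by
    rw [← hrz]; nlinarith)
  rw [← hrz] at hγlt hγle hγge
  have hup : u (γ (4 * d)) ≤ (2 * d) ^ (4 * d) * κ :=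
    h.le_pow_mul_of_path hd0 (FinalState.pointMass_nonneg hκd.le) (by linarith) (hγ0 ▸ hz) hγ _
      fun j hj hjd => hball _ (hγlt j hj hjd.le)
  have hlow : r * (r ^ d)⁻¹ ≤ ψ (γ (4 * d)) - m := by
    obtain ⟨y, hy⟩ : ∃ y, y = γ (4 * d) := ⟨_, rfl⟩
    rw [← hy] at hγle hγge ⊢
    rw [hψρ y (by nlinarith), hm, ← rpow_sq_half (by linarith)]
    have hy3 : (d : ℝ) + 2 ≤ enorm2 y := by nlinarith
    have h1 : (0 : ℝ) < enorm2 y ^ 2 - (d + 1) := by nlinarith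
    have h2 : enorm2 y ^ 2 ≤ (r - 2) ^ 2 := by
      have := enorm2_nonneg y
      gcongr
    -- The inward gain of `2` beats the radius `r - 1` by one, so the squared radii differ by at
    -- least `2 * r - 3`.
    have h3 : r ≤ (r - 1) ^ 2 - (d + 1) - (enorm2 y ^ 2 - (d + 1)) := by nlinarith
    refine le_trans ?_ (primitive_sub_bounds hp hF h1 (by linarith)).1
    have h4 : (r ^ 2) ^ (-((d : ℝ) / 2)) ≤ ((r - 1) ^ 2 - (d + 1)) ^ (-((d : ℝ) / 2)) :=
      Real.rpow_le_rpow_of_nonpos (by linarith) (by nlinarith) (by linarith)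
    have h5 : 0 ≤ (r ^ 2) ^ (-((d : ℝ) / 2)) := Real.rpow_nonneg (sq_nonneg r) _
    exact mul_le_mul h3 h4 h5 (by linarith)
  have hr0 : 0 < r := by linarith
  have key : ε * κ ^ d * (r * (r ^ d)⁻¹) ≤ (2 * d) ^ (4 * d) * κ := by
    have h1 := hcomp (γ (4 * d))
    have h2 := mul_le_mul_of_nonneg_left hlow (by positivity : 0 ≤ ε * κ ^ d)
    linarith
  rw [hc]
  exact min_mul_le_of_flux_le hd hε (by positivity) (by linarith) hr0 key

end BoundarySandpile

/-! ### Assembly of the two bounds. -/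

theorem lemma4p11 (d : ℕ) (hd : 2 ≤ d) :
    ∃ c₁ C₁ : ℝ, 0 < c₁ ∧ c₁ < C₁ ∧ ∃ N : ℝ, 1 < N ∧ ∀ n : ℝ, N ≤ n →
      ∀ T : ℕ → BoundarySandpile.Lattice d, BoundarySandpile.Infinitive T →
        BoundarySandpile.discBall d (c₁ * n ^ (1 / (d : ℝ))) ⊆
            BoundarySandpile.visitedSites (BoundarySandpile.pointMass d n) (n ^ (1 / (d : ℝ))) T ∧
        BoundarySandpile.visitedSites (BoundarySandpile.pointMass d n) (n ^ (1 / (d : ℝ))) T ⊆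
            BoundarySandpile.discBall d (C₁ * n ^ (1 / (d : ℝ))) := by
  open BoundarySandpile in
  have hd0 : d ≠ 0 := by omega
  have hd2 : (2 : ℝ) ≤ d := by exact_mod_cast hd
  obtain ⟨C, hC1, hC⟩ := exists_supersolution hd
  obtain ⟨c, hc0, M, hc⟩ := exists_inner_radius hd
  obtain ⟨Q, hQ⟩ : ∃ Q : ℝ, Q = (2 * d) ^ M := ⟨_, rfl⟩
  have hQ1 : 1 ≤ Q := hQ ▸ one_le_pow₀ (by linarith)
  -- Halving `c` makes room for the extra layer of `Z_R`: `|z| ≥ c * κ` and `|z| ≤ c / 2 * κ + 1`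
  -- force `|z| ≤ 2`, against `4 ≤ |z|`. The `1 / 2` only ensures `c₁ < C₁`, and `(Q + 1) ^ d`
  -- ensures `κ > Q`.
  refine ⟨min (c / 2) (1 / 2), C, lt_min (by positivity) (by norm_num),
    (min_le_right _ _).trans_lt (by linarith), (Q + 1) ^ d, one_lt_pow₀ (by linarith) hd0, ?_⟩
  intro n hn T hT
  obtain ⟨κ, hκ⟩ : ∃ κ, κ = n ^ (1 / (d : ℝ)) := ⟨_, rfl⟩
  have hn0 : 0 ≤ n := le_trans (by positivity) hn
  have hκn : κ ^ d = n := by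
    rw [hκ, one_div, Real.rpow_inv_natCast_pow hn0 hd0]
  have hκ0 : 0 ≤ κ := by rw [hκ]; positivity
  rw [← hκ, ← hκn]
  rw [← hκn] at hn
  have hQκ : Q + 1 ≤ κ := le_of_pow_le_pow_left₀ hd0 hκ0 hn
  have hκ1 : 1 ≤ κ := by linarith
  have hκd : 0 < κ ^ d := by positivity
  obtain ⟨w, hw0, hwin, hwout⟩ := hC κ hκ1
  have hCκ : 0 ≤ C * κ := by positivity
  have hproc := process_le_supersolution hd0 hκ0 (μ₀ := pointMass d (κ ^ d)) hCκ hw0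
    (fun x hx => by
      have : x ≠ 0 := by
        rintro rfl
        rw [enorm2_zero] at hx
        linarith
      simp [pointMass, this]) hwin hwout T
  refine ⟨?_, Set.iUnion_subset fun k => (hproc k).2⟩
  obtain ⟨u, hu⟩ := exists_finalState hκ0 hT fun k => (hproc k).1
  have h0 : (0 : Lattice d) ∈ visitedSites (pointMass d (κ ^ d)) κ T :=
    Set.mem_iUnion.2 ⟨0, by simp [process, initialState, pointMass, hκd.ne']⟩
  have hMκ : (2 * (d : ℝ)) ^ M * κ < κ ^ d := by
    rw [← hQ]
    calc Q * κ < κ * κ := by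
          have : Q < κ := by linarith
          gcongr
      _ = κ ^ 2 := by ring
      _ ≤ κ ^ d := pow_le_pow_right₀ hκ1 hd
  intro z hz
  by_contra hzV
  obtain ⟨h4, hcz⟩ := hc κ hκ1 hMκ _ u hu h0 z hzV
  have h1 := enorm2_le_of_mem_discBall hz
  have h2 : min (c / 2) (1 / 2) * κ ≤ c / 2 * κ := by
    have := min_le_left (c / 2) (1 / 2)
    gcongr
  linarith
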